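/- Let $\Bbbk$ be a field, $H$ a bialgebra over $\Bbbk$, and $V$ a finite-dimensional quasi-Yetter–Drinfeld module over $H$: a left $H$-module with a linear map $\delta\colon V\to H\otimes V$, $v\mapsto v^{[-1]}\otimes v^{[0]}$, such that $(h_{(1)}\triangleright v)^{[-1]}h_{(2)}\otimes(h_{(1)}\triangleright v)^{[0]}=h_{(1)}v^{[-1]}\otimes h_{(2)}\triangleright v^{[0]}$ for all $h\in H$, $v\in V$. Let $H$ act on $V^*$ on the right by $\langle f\triangleleft h,v\rangle=\langle f,h\triangleright v\rangle$, and put $\beta(f,v)=v^{[-1]}\langle f,v^{[0]}\rangle$. Let $\tilde A=\tilde A(V,\delta)$ be the free braided double: the algebra generated by $V$, $H$, $V^*$ subject to the relations of $H$ (with $1_H=1$), $hv=(h_{(1)}\triangleright v)h_{(2)}$, $fh=h_{(1)}(f\triangleleft h_{(2)})$ and $fv-vf=\beta(f,v)$. A triangular ideal of $\tilde A$ is a two-sided ideal of the form $I^-\otimes H\otimes T(V^*)+T(V)\otimes H\otimes I^+$ (the image in $\tilde A$ under multiplication) with subspaces $I^-\subseteq T^{>0}(V)$, $I^+\subseteq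 T^{>0}(V^*)$. A $(V,\delta)$-braided double is a quotient of $\tilde A$ by a triangular ideal; a quotient double of a braided double $A$ is a quotient of $A$ by a two-sided ideal that is again a $(V,\delta)$-braided double; a minimal double is a braided double without proper quotient doubles. **1.** A triangular ideal determines $I^-$ and $I^+$, as its preimages in $T(V)$ and $T(V^*)$, and for every braided double $A$ multiplication gives a bijection $T(V)/I^-\otimes H\otimes T(V^*)/I^+\to A$. The sum of all triangular ideals of $\tilde A$ is the largest triangular ideal $I_{\tilde A}$; a braided double is minimal if and only if it is the quotient of $\tilde A$ by $I_{\tilde A}$; and every braided double has a unique quotient double that is a minimal double. **2.** Let $I(V,\delta)\subset T(V)$ and $I(V^*,\delta)\subset T(V^*)$ be the preimages of $I_{\tilde A}$. Then $I_{\tilde A}=I(V,\delta)\otimes H\otimes T(V^*)+T(V)\otimes H\otimes I(V^*,\delta)$, and $I(V,\delta)\subseteq T^{>0}(V)$, $I(V^*,\delta)\subseteq T^{>0}(V^*)$ are $H$-invariant graded two-sided ideals. **3.** If $H$ is a Hopf algebra, then $$I(V,\delta)=\bigoplus_{n\ge1}\ker\widetilde{[n]}!_\delta,\qquad I(V^*,\delta)=\bigoplus_{n\ge1}\ker\widetilde{[n]}!_{\delta_r}.$$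 Here the quasibraided integers $\widetilde{[n]}_\delta\colon V^{\otimes n}\to V^{\otimes n-1}\otimes H\otimes V$ are $$\widetilde{[n]}_\delta(v_1\otimes\dots\otimes v_n)=\sum_{i=1}^n v_1\otimes\dots\otimes v_{i-1}\otimes {v_i^{[-1]}}_{(1)}\triangleright(v_{i+1}\otimes\dots\otimes v_n)\otimes {v_i^{[-1]}}_{(2)}\otimes v_i^{[0]},$$ and the quasibraided factorials $\widetilde{[n]}!_\delta\colon V^{\otimes n}\to(H\otimes V)^{\otimes n}$ are given by $\widetilde{[0]}!_\delta=1$, $\widetilde{[n]}!_\delta=(\widetilde{[n-1]}!_\delta\otimes\mathrm{id}_{H\otimes V})\circ\widetilde{[n]}_\delta$. On the right side, $\delta_r\colon V^*\to V^*\otimes H$, $f\mapsto f^{[0]}\otimes f^{[1]}$, is determined by $\beta(f,v)=\langle f^{[0]},v\rangle f^{[1]}$, and $\widetilde{[n]}_{\delta_r}\colon V^{*\otimes n}\to V^*\otimes H\otimes V^{*\otimes n-1}$ is $$\widetilde{[n]}_{\delta_r}(f_1\otimes\dots\otimes f_n)=\sum_{i=1}^n f_i^{[0]}\otimes {f_i^{[1]}}_{(1)}\otimes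 (f_1\otimes\dots\otimes f_{i-1})\triangleleft {f_i^{[1]}}_{(2)}\otimes f_{i+1}\otimes\dots\otimes f_n,$$ with $\widetilde{[0]}!_{\delta_r}=1$ and $\widetilde{[n]}!_{\delta_r}=(\mathrm{id}_{V^*\otimes H}\otimes\widetilde{[n-1]}!_{\delta_r})\circ\widetilde{[n]}_{\delta_r}\colon V^{*\otimes n}\to(V^*\otimes H)^{\otimes n}$. -/

import Mathlib

open scoped TensorProduct

noncomputable section

namespace BraidedDouble

universe u v w x

section TensorPowers

variable (k : Type u) (M : Type v) [CommRing k] [AddCommGroup M] [Module k M]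

/-- `m ⊗ (m₁ ⊗ ⋯ ⊗ mₙ) ↦ m ⊗ m₁ ⊗ ⋯ ⊗ mₙ`, as an isomorphism `M ⊗ M^{⊗n} ≃ M^{⊗(n+1)}`. -/
def consEquiv (n : ℕ) : M ⊗[k] (⨂[k]^n M) ≃ₗ[k] (⨂[k]^(n + 1) M) :=
  (TensorProduct.congr (PiTensorProduct.subsingletonEquiv (R := k) (s := fun _ : Fin 1 => M) 0).symm
      (LinearEquiv.refl k (⨂[k]^n M))).trans
    ((TensorPower.mulEquiv (R := k) (M := M) (n := 1) (m := n)).trans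
      (TensorPower.cast k M (Nat.add_comm 1 n)))

/-- `(m₁ ⊗ ⋯ ⊗ mₙ) ⊗ m ↦ m₁ ⊗ ⋯ ⊗ mₙ ⊗ m`, as an isomorphism `M^{⊗n} ⊗ M ≃ M^{⊗(n+1)}`. -/
def snocEquiv (n : ℕ) : (⨂[k]^n M) ⊗[k] M ≃ₗ[k] (⨂[k]^(n + 1) M) :=
  (TensorProduct.congr (LinearEquiv.refl k (⨂[k]^n M))
      (PiTensorProduct.subsingletonEquiv (R := k) (s := fun _ : Fin 1 => M) 0).symm).trans
    (TensorPower.mulEquiv (R := k) (M := M) (n := n) (m := 1))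

variable {k M}

lemma subsingletonEquiv_symm_eq (m : M) :
    (PiTensorProduct.subsingletonEquiv (R := k) (s := fun _ : Fin 1 => M) 0).symm m =
      PiTensorProduct.tprod k (fun _ : Fin 1 => m) := by
  rw [LinearEquiv.symm_apply_eq, PiTensorProduct.subsingletonEquiv_apply_tprod]

theorem consEquiv_tprod (n : ℕ) (m : M) (a : Fin n → M) :
    consEquiv k M n (m ⊗ₜ PiTensorProduct.tprod k a) =
      PiTensorProduct.tprod k (Fin.cons m a : Fin (n + 1) → M) := by
  have h := TensorPower.tprod_mul_tprod k (fun _ : Fin 1 => m) a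
  rw [TensorPower.gMul_def] at h
  simp only [consEquiv, LinearEquiv.trans_apply, TensorProduct.congr_tmul, LinearEquiv.refl_apply,
    subsingletonEquiv_symm_eq, h, TensorPower.cast_tprod]
  congr 1
  rw [Fin.append_left_eq_cons]
  funext i
  simp

theorem snocEquiv_tprod (n : ℕ) (m : M) (a : Fin n → M) :
    snocEquiv k M n (PiTensorProduct.tprod k a ⊗ₜ m) =
      PiTensorProduct.tprod k (Fin.snoc a m : Fin (n + 1) → M) := by
  have h := TensorPower.tprod_mul_tprod k a (fun _ : Fin 1 => m)
  rw [TensorPower.gMul_def] at h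
  simp only [snocEquiv, LinearEquiv.trans_apply, TensorProduct.congr_tmul, LinearEquiv.refl_apply,
    subsingletonEquiv_symm_eq, h]
  congr 1
  rw [Fin.append_right_eq_snoc]

end TensorPowers

variable {k : Type u} {H : Type v} {V : Type w}
variable [Field k] [Ring H] [Bialgebra k H]

/-- Given a (left or right) action of the bialgebra `H` on `M`, the action on `M^{⊗n}` through the
coproduct: `h · 1 = ε(h)` for `n = 0`, and `h · (m ⊗ t) = (h₍₁₎ · m) ⊗ (h₍₂₎ · t)`. -/
def powAct {M : Type w} [AddCommGroup M] [Module k M] (act : H →ₗ[k] M →ₗ[k] M) :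
    (n : ℕ) → H →ₗ[k] (⨂[k]^n M) →ₗ[k] (⨂[k]^n M)
  | 0 => LinearMap.smulRight (Coalgebra.counit (R := k) (A := H)) LinearMap.id
  | n + 1 =>
      (consEquiv k M n).conj.toLinearMap ∘ₗ
        TensorProduct.lift (TensorProduct.mapBilinear (RingHom.id k) M (⨂[k]^n M) M (⨂[k]^n M)) ∘ₗ
          TensorProduct.map act (powAct act n) ∘ₗ Coalgebra.comul

/-- The bialgebra `H` is a Hopf algebra (it has an antipode). -/
def IsHopf (k : Type u) (H : Type v) [Field k] [Ring H] [B : Bialgebra k H] : Prop :=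
  ∃ A : HopfAlgebra k H, A.toBialgebra = B

variable [AddCommGroup V] [Module k V] [Module H V] [IsScalarTower k H V]

/-- The left action `h ↦ (v ↦ h ▷ v)` of `H` on `V`. -/
def lact (k : Type u) (H : Type v) (V : Type w) [Field k] [Ring H] [Bialgebra k H]
    [AddCommGroup V] [Module k V] [Module H V] [IsScalarTower k H V] : H →ₗ[k] V →ₗ[k] V :=
  (Algebra.lsmul k k V).toLinearMap

/-- The right action `h ↦ (f ↦ f ◁ h)` of `H` on `V*`: `⟨f ◁ h, v⟩ = ⟨f, h ▷ v⟩`. -/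
def ract (k : Type u) (H : Type v) (V : Type w) [Field k] [Ring H] [Bialgebra k H]
    [AddCommGroup V] [Module k V] [Module H V] [IsScalarTower k H V] :
    H →ₗ[k] Module.Dual k V →ₗ[k] Module.Dual k V :=
  (LinearMap.llcomp k V V k).flip ∘ₗ lact k H V

/-- The Yetter–Drinfeld compatibility condition for a quasicoaction `δ : V → H ⊗ V`,
`v ↦ v⁻¹ ⊗ v⁰` (an arbitrary linear map):
`(h₍₁₎ ▷ v)⁻¹ h₍₂₎ ⊗ (h₍₁₎ ▷ v)⁰ = h₍₁₎ v⁻¹ ⊗ h₍₂₎ ▷ v⁰`. With it, `(V, δ)` is a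
quasi-Yetter–Drinfeld module over `H`. -/
def IsQuasiYD (δ : V →ₗ[k] H ⊗[k] V) : Prop :=
  ∀ (h : H) (v : V),
    TensorProduct.lift
        (LinearMap.mk₂ k (fun a b : H => LinearMap.rTensor V (LinearMap.mulRight k b) (δ (a • v)))
          (fun a a' b => by simp [add_smul])
          (fun c a b => by simp)
          (fun a b b' => by
            rw [show LinearMap.mulRight k (b + b') =
              LinearMap.mulRight k b + LinearMap.mulRight k b' by ext; simp [mul_add],
              LinearMap.rTensor_add, LinearMap.add_apply])
          (fun c a b => by
            rw [show LinearMap.mulRight k (c • b) = c • LinearMap.mulRight k b by ext; simp,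
              LinearMap.rTensor_smul, LinearMap.smul_apply]))
        (Coalgebra.comul (R := k) h) =
      TensorProduct.map
          (TensorProduct.lift (LinearMap.mul k H)) (TensorProduct.lift (lact k H V))
        (TensorProduct.tensorTensorTensorComm k H H H V (Coalgebra.comul (R := k) h ⊗ₜ δ v))

/-- The `H`-valued pairing `β(f, v) = v⁻¹ ⟨f, v⁰⟩` between `V*` and `V`. -/
def pairing (δ : V →ₗ[k] H ⊗[k] V) (f : Module.Dual k V) : V →ₗ[k] H :=
  (TensorProduct.rid k H).toLinearMap ∘ₗ LinearMap.lTensor H f ∘ₗ δ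

section Double

/-- The free algebra on `V`, `H` and `V*` (tensor algebra of the direct sum of these spaces). -/
abbrev Pre (k : Type u) (H : Type v) (V : Type w) [Field k] [Ring H] [Bialgebra k H]
    [AddCommGroup V] [Module k V] :=
  TensorAlgebra k (V × H × Module.Dual k V)

/-- The generators `v ∈ V`. -/
def preV (k : Type u) (H : Type v) (V : Type w) [Field k] [Ring H] [Bialgebra k H]
    [AddCommGroup V] [Module k V] : V →ₗ[k] Pre k H V :=
  TensorAlgebra.ι k ∘ₗ LinearMap.inl k V (H × Module.Dual k V)

/-- The generators `h ∈ H`. -/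
def preH (k : Type u) (H : Type v) (V : Type w) [Field k] [Ring H] [Bialgebra k H]
    [AddCommGroup V] [Module k V] : H →ₗ[k] Pre k H V :=
  TensorAlgebra.ι k ∘ₗ LinearMap.inr k V (H × Module.Dual k V) ∘ₗ
    LinearMap.inl k H (Module.Dual k V)

/-- The generators `f ∈ V*`. -/
def preF (k : Type u) (H : Type v) (V : Type w) [Field k] [Ring H] [Bialgebra k H]
    [AddCommGroup V] [Module k V] : Module.Dual k V →ₗ[k] Pre k H V :=
  TensorAlgebra.ι k ∘ₗ LinearMap.inr k V (H × Module.Dual k V) ∘ₗ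
    LinearMap.inr k H (Module.Dual k V)

/-- The defining relations of the double. -/
inductive Rel (δ : V →ₗ[k] H ⊗[k] V) : Pre k H V → Pre k H V → Prop
  /-- the unity of `H` is the unity -/
  | one : Rel δ (preH k H V 1) 1
  /-- all relations between elements of `H` hold -/
  | mul (a b : H) : Rel δ (preH k H V (a * b)) (preH k H V a * preH k H V b)
  /-- `h v = (h₍₁₎ ▷ v) h₍₂₎` -/
  | left (h : H) (v : V) : Rel δ (preH k H V h * preV k H V v)
      (LinearMap.mul' k _ (TensorProduct.map (preV k H V ∘ₗ (lact k H V).flip v) (preH k H V)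
        (Coalgebra.comul (R := k) h)))
  /-- `f h = h₍₁₎ (f ◁ h₍₂₎)` -/
  | right (f : Module.Dual k V) (h : H) : Rel δ (preF k H V f * preH k H V h)
      (LinearMap.mul' k _ (TensorProduct.map (preH k H V) (preF k H V ∘ₗ (ract k H V).flip f)
        (Coalgebra.comul (R := k) h)))
  /-- `f v - v f = β(f, v)` -/
  | comm (f : Module.Dual k V) (v : V) : Rel δ
      (preF k H V f * preV k H V v - preV k H V v * preF k H V f) (preH k H V (pairing δ f v))

variable (δ : V →ₗ[k] H ⊗[k] V)

/-- The algebra `Ã(V, δ)`, given by generators and relations; when `(V, δ)` is a quasi-YD module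
it is the free braided double of `(V, δ)`. -/
abbrev FreeDouble : Type _ := RingQuot (Rel δ)

/-- The canonical map `T(V) → Ã(V, δ)`. -/
def incV : TensorAlgebra k V →ₐ[k] FreeDouble δ :=
  TensorAlgebra.lift k ((RingQuot.mkAlgHom k (Rel δ)).toLinearMap ∘ₗ preV k H V)

/-- The canonical map `H → Ã(V, δ)`. -/
def incH : H →ₗ[k] FreeDouble δ :=
  (RingQuot.mkAlgHom k (Rel δ)).toLinearMap ∘ₗ preH k H V

/-- The canonical map `T(V*) → Ã(V, δ)`. -/
def incF : TensorAlgebra k (Module.Dual k V) →ₐ[k] FreeDouble δ :=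
  TensorAlgebra.lift k ((RingQuot.mkAlgHom k (Rel δ)).toLinearMap ∘ₗ preF k H V)

/-- The ideal `T^{>0}(M) = ⊕_{n>0} M^{⊗n}` of the tensor algebra. -/
def posPart (k : Type u) (M : Type x) [Field k] [AddCommGroup M] [Module k M] :
    Submodule k (TensorAlgebra k M) :=
  LinearMap.ker (TensorAlgebra.algebraMapInv (R := k) (M := M)).toLinearMap

/-- `J` is a two-sided ideal of the form `I⁻ ⊗ H ⊗ T(V*) + T(V) ⊗ H ⊗ I⁺` with subspaces
`I⁻ ⊆ T^{>0}(V)` and `I⁺ ⊆ T^{>0}(V*)`. -/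
structure HasTriangularForm (J : Ideal (FreeDouble δ)) (Im : Submodule k (TensorAlgebra k V))
    (Ip : Submodule k (TensorAlgebra k (Module.Dual k V))) : Prop where
  twoSided : J.IsTwoSided
  minus_le : Im ≤ posPart k V
  plus_le : Ip ≤ posPart k (Module.Dual k V)
  eq : J.restrictScalars k =
    Im.map (incV δ).toLinearMap * LinearMap.range (incH δ) *
        LinearMap.range (incF δ).toLinearMap ⊔
      LinearMap.range (incV δ).toLinearMap * LinearMap.range (incH δ) *
        Ip.map (incF δ).toLinearMap

/-- Triangular ideals of `Ã(V, δ)`. -/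
def IsTriangularIdeal (J : Ideal (FreeDouble δ)) : Prop :=
  ∃ Im Ip, HasTriangularForm δ J Im Ip

/-- `A`, as a quotient of `Ã(V, δ)` through `q`, is a `(V, δ)`-braided double: `q` is onto and its
kernel is a triangular ideal. -/
def IsBraidedDouble {A : Type x} [Ring A] [Algebra k A] (q : FreeDouble δ →ₐ[k] A) : Prop :=
  Function.Surjective q ∧ IsTriangularIdeal δ (RingHom.ker q)

/-- The ideal `K` of the `(V, δ)`-braided double `A` is two-sided, and `A / K` is again a
`(V, δ)`-braided double. -/
def IsQuotientDouble {A : Type x} [Ring A] [Algebra k A] (q : FreeDouble δ →ₐ[k] A)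
    (K : Ideal A) : Prop :=
  ∃ _ : K.IsTwoSided, IsBraidedDouble δ ((Ideal.Quotient.mkₐ k K).comp q)

/-- A minimal double: a braided double without proper quotient doubles. -/
def IsMinimalDouble {A : Type x} [Ring A] [Algebra k A] (q : FreeDouble δ →ₐ[k] A) : Prop :=
  IsBraidedDouble δ q ∧ ∀ K : Ideal A, IsQuotientDouble δ q K → K = ⊥

/-- The sum of all triangular ideals of `Ã(V, δ)`. -/
def sumTriangular : Ideal (FreeDouble δ) := sSup {J | IsTriangularIdeal δ J}

/-- The defining ideal `I(V, δ)` of the minimal double in `T(V)`. -/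
def idealV : Ideal (TensorAlgebra k V) := (sumTriangular δ).comap (incV δ)

/-- The defining ideal `I(V*, δ)` of the minimal double in `T(V*)`. -/
def idealF : Ideal (TensorAlgebra k (Module.Dual k V)) := (sumTriangular δ).comap (incF δ)

/-- For a quotient `q : Ã(V, δ) → A`, with `I⁻`, `I⁺` the kernels of `T(V) → A`, `T(V*) → A`, the
map `T(V)/I⁻ ⊗ H ⊗ T(V*)/I⁺ → A` given by multiplication in `A`. -/
def triangularMap {A : Type x} [Ring A] [Algebra k A] (q : FreeDouble δ →ₐ[k] A) :
    (TensorAlgebra k V ⧸ LinearMap.ker (q.comp (incV δ)).toLinearMap) ⊗[k] H ⊗[k]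
      (TensorAlgebra k (Module.Dual k V) ⧸ LinearMap.ker (q.comp (incF δ)).toLinearMap) →ₗ[k] A :=
  LinearMap.mul' k A ∘ₗ TensorProduct.map
    (LinearMap.mul' k A ∘ₗ TensorProduct.map
      (Submodule.liftQ _ (q.comp (incV δ)).toLinearMap le_rfl) (q.toLinearMap ∘ₗ incH δ))
    (Submodule.liftQ _ (q.comp (incF δ)).toLinearMap le_rfl)

end Double

section LeftFactorials

variable (δ : V →ₗ[k] H ⊗[k] V)

/-- `v ⊗ t ↦ (v⁻¹₍₁₎ ▷ t) ⊗ v⁻¹₍₂₎ ⊗ v⁰` for `v ∈ V`, `t ∈ V^{⊗n}`. -/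
def headTerm (n : ℕ) : V ⊗[k] (⨂[k]^n V) →ₗ[k] (⨂[k]^n V) ⊗[k] (H ⊗[k] V) :=
  LinearMap.rTensor (H ⊗[k] V) (TensorProduct.lift (powAct (lact k H V) n)) ∘ₗ
    (TensorProduct.rightComm k H (H ⊗[k] V) (⨂[k]^n V)).toLinearMap ∘ₗ
      LinearMap.rTensor (⨂[k]^n V)
        ((TensorProduct.assoc k H H V).toLinearMap ∘ₗ
          LinearMap.rTensor V (Coalgebra.comul (R := k) (A := H)) ∘ₗ δ)

/-- `quasiInt δ n` is the quasibraided integer `[n+1]~ : V^{⊗(n+1)} → V^{⊗n} ⊗ (H ⊗ V)`,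
`v₁ ⊗ ⋯ ⊗ vₙ₊₁ ↦ ∑ᵢ v₁ ⊗ ⋯ ⊗ vᵢ₋₁ ⊗ (vᵢ⁻¹₍₁₎ ▷ (vᵢ₊₁ ⊗ ⋯ ⊗ vₙ₊₁)) ⊗ vᵢ⁻¹₍₂₎ ⊗ vᵢ⁰`.
The term `i = 1` is `headTerm`; the terms with `i > 1` are `v₁ ⊗ [n]~(v₂ ⊗ ⋯ ⊗ vₙ₊₁)`. -/
def quasiInt : (n : ℕ) → (⨂[k]^(n + 1) V) →ₗ[k] (⨂[k]^n V) ⊗[k] (H ⊗[k] V)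
  | 0 => headTerm δ 0 ∘ₗ (consEquiv k V 0).symm.toLinearMap
  | n + 1 =>
      (headTerm δ (n + 1) +
        LinearMap.rTensor (H ⊗[k] V) (consEquiv k V n).toLinearMap ∘ₗ
          (TensorProduct.assoc k V (⨂[k]^n V) (H ⊗[k] V)).symm.toLinearMap ∘ₗ
            LinearMap.lTensor V (quasiInt n)) ∘ₗ
        (consEquiv k V (n + 1)).symm.toLinearMap

/-- The quasibraided factorial `[n]~! : V^{⊗n} → (H ⊗ V)^{⊗n}`: `[0]~! = 1` and
`[n+1]~! = ([n]~! ⊗ id_{H ⊗ V}) ∘ [n+1]~`. -/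
def quasiFactorial : (n : ℕ) → (⨂[k]^n V) →ₗ[k] (⨂[k]^n (H ⊗[k] V))
  | 0 => ((PiTensorProduct.isEmptyEquiv (R := k) (s := fun _ : Fin 0 => V) (Fin 0)).trans
      (PiTensorProduct.isEmptyEquiv (R := k) (s := fun _ : Fin 0 => H ⊗[k] V)
        (Fin 0)).symm).toLinearMap
  | n + 1 =>
      (snocEquiv k (H ⊗[k] V) n).toLinearMap ∘ₗ
        LinearMap.rTensor (H ⊗[k] V) (quasiFactorial n) ∘ₗ quasiInt δ n

end LeftFactorials

section RightFactorials

variable [Module.Finite k V] (δ : V →ₗ[k] H ⊗[k] V)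

/-- The right quasicoaction `δᵣ : V* → V* ⊗ H`, `f ↦ f⁰ ⊗ f¹`, determined by
`β(f, v) = ⟨f⁰, v⟩ f¹`. -/
def rightQuasicoaction : Module.Dual k V →ₗ[k] Module.Dual k V ⊗[k] H :=
  (dualTensorHomEquiv k V H).symm.toLinearMap ∘ₗ
    LinearMap.mk₂ k (fun f v => pairing δ f v)
      (fun f f' v => by simp [pairing, LinearMap.lTensor_add])
      (fun c f v => by simp [pairing, LinearMap.lTensor_smul])
      (fun f v v' => by simp)
      (fun c f v => by simp)

/-- `t ⊗ f ↦ f⁰ ⊗ f¹₍₁₎ ⊗ (t ◁ f¹₍₂₎)` for `t ∈ V*^{⊗n}`, `f ∈ V*`. -/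
def tailTerm (n : ℕ) : (⨂[k]^n (Module.Dual k V)) ⊗[k] Module.Dual k V →ₗ[k]
    (Module.Dual k V ⊗[k] H) ⊗[k] (⨂[k]^n (Module.Dual k V)) :=
  LinearMap.lTensor (Module.Dual k V ⊗[k] H)
      (TensorProduct.lift (powAct (ract k H V) n).flip) ∘ₗ
    (TensorProduct.leftComm k (⨂[k]^n (Module.Dual k V)) (Module.Dual k V ⊗[k] H) H).toLinearMap ∘ₗ
      LinearMap.lTensor (⨂[k]^n (Module.Dual k V))
        ((TensorProduct.assoc k (Module.Dual k V) H H).symm.toLinearMap ∘ₗ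
          LinearMap.lTensor (Module.Dual k V) (Coalgebra.comul (R := k) (A := H)) ∘ₗ
            rightQuasicoaction δ)

/-- `quasiIntRight δ n` is the right-handed quasibraided integer
`[n+1]~ : V*^{⊗(n+1)} → (V* ⊗ H) ⊗ V*^{⊗n}`,
`f₁ ⊗ ⋯ ⊗ fₙ₊₁ ↦ ∑ᵢ fᵢ⁰ ⊗ fᵢ¹₍₁₎ ⊗ ((f₁ ⊗ ⋯ ⊗ fᵢ₋₁) ◁ fᵢ¹₍₂₎) ⊗ fᵢ₊₁ ⊗ ⋯ ⊗ fₙ₊₁`.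
The term `i = n+1` is `tailTerm`; the other terms are `[n]~(f₁ ⊗ ⋯ ⊗ fₙ) ⊗ fₙ₊₁`. -/
def quasiIntRight : (n : ℕ) → (⨂[k]^(n + 1) (Module.Dual k V)) →ₗ[k]
    (Module.Dual k V ⊗[k] H) ⊗[k] (⨂[k]^n (Module.Dual k V))
  | 0 => tailTerm δ 0 ∘ₗ (snocEquiv k (Module.Dual k V) 0).symm.toLinearMap
  | n + 1 =>
      (tailTerm δ (n + 1) +
        LinearMap.lTensor (Module.Dual k V ⊗[k] H) (snocEquiv k (Module.Dual k V) n).toLinearMap ∘ₗ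
          (TensorProduct.assoc k (Module.Dual k V ⊗[k] H) (⨂[k]^n (Module.Dual k V))
            (Module.Dual k V)).toLinearMap ∘ₗ
            LinearMap.rTensor (Module.Dual k V) (quasiIntRight n)) ∘ₗ
        (snocEquiv k (Module.Dual k V) (n + 1)).symm.toLinearMap

/-- The right-handed quasibraided factorial `[n]~! : V*^{⊗n} → (V* ⊗ H)^{⊗n}`: `[0]~! = 1` and
`[n+1]~! = (id_{V* ⊗ H} ⊗ [n]~!) ∘ [n+1]~`. -/
def quasiFactorialRight :
    (n : ℕ) → (⨂[k]^n (Module.Dual k V)) →ₗ[k] (⨂[k]^n (Module.Dual k V ⊗[k] H))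
  | 0 => ((PiTensorProduct.isEmptyEquiv (R := k) (s := fun _ : Fin 0 => Module.Dual k V)
      (Fin 0)).trans
      (PiTensorProduct.isEmptyEquiv (R := k) (s := fun _ : Fin 0 => Module.Dual k V ⊗[k] H)
        (Fin 0)).symm).toLinearMap
  | n + 1 =>
      (consEquiv k (Module.Dual k V ⊗[k] H) n).toLinearMap ∘ₗ
        LinearMap.lTensor (Module.Dual k V ⊗[k] H) (quasiFactorialRight n) ∘ₗ quasiIntRight δ n

end RightFactorials

end BraidedDouble

end

/-
The free double acts on `T(V) ⊗ H ⊗ T(V*)` by left multiplication, written out through the defining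
relations; applying it to `1 ⊗ 1 ⊗ 1` inverts the multiplication map and gives the triangular
decomposition. Projecting an element to `T(V)` or `T(V*)` along this decomposition recovers the two
halves of a triangular ideal, while a sum of triangular ideals is triangular with the summed halves;
hence there is a largest one, and it governs minimality. It is homogeneous because the homogeneous
components of a triangular ideal lie in a triangular ideal.

For `u ∈ V^{⊗n}` the commutator `f u - u f` is the contraction of the last leg of `[n]~ u` with `f`,
an element of `T(V) ⊗ H`. If `u ∈ I(V, δ)`, its `T(V)`-legs lie in `I(V, δ)` again, so by induction
`[n]~! u = 0`. Conversely, if `[n]~! u = 0` then `[n]~ u` lies in `ker [n-1]~! ⊗ H ⊗ V` by exactness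
of the tensor product, so commutators of `V*` with the kernels stay in the kernels times `H`. Over a
Hopf algebra the kernels are moreover `H`-invariant, since `h ▷ u = h₍₁₎ u S(h₍₂₎)`, and hence
generate a triangular ideal.
-/

noncomputable section

namespace BraidedDouble

open scoped Coalgebra

universe u v w x

/-! ### Sweedler sums and recursion on free modules -/

section Sweedler

variable {k : Type u} {H : Type v} [CommSemiring k] {X : Type*} [AddCommMonoid X] [Module k X]

section Coalgebra

variable [AddCommMonoid H] [Module k H] [Coalgebra k H]

/-- The linear map `h ↦ B(h₍₁₎, h₍₂₎)` attached to a bilinear map `B`. -/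
def sweedler (B : H →ₗ[k] H →ₗ[k] X) : H →ₗ[k] X :=
  TensorProduct.lift B ∘ₗ Coalgebra.comul

theorem sweedler_eq_sum {ι : Type*} (B : H →ₗ[k] H →ₗ[k] X) {h : H} (r : Coalgebra.Repr k h ι) :
    sweedler B h = ∑ i ∈ r.index, B (r.left i) (r.right i) := by
  simp [sweedler, ← r.eq]

theorem sum_sum_coassoc {ι : Type*} {κ κ' : ι → Type*} (φ : H →ₗ[k] H →ₗ[k] H →ₗ[k] X) {h : H}
    (r : Coalgebra.Repr k h ι) (a : ∀ i, Coalgebra.Repr k (r.left i) (κ i))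
    (b : ∀ i, Coalgebra.Repr k (r.right i) (κ' i)) :
    ∑ i ∈ r.index, ∑ j ∈ (a i).index, φ ((a i).left j) ((a i).right j) (r.right i) =
      ∑ i ∈ r.index, ∑ j ∈ (b i).index, φ (r.left i) ((b i).left j) ((b i).right j) := by
  simpa using congrArg (TensorProduct.lift (TensorProduct.uncurry (RingHom.id k) H H X ∘ₗ φ))
    (Coalgebra.sum_tmul_tmul_eq r a b)

end Coalgebra

variable [Semiring H] [Bialgebra k H] (B : H →ₗ[k] H →ₗ[k] X)

theorem sweedler_one : sweedler B 1 = B 1 1 := by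
  simp [sweedler, Algebra.TensorProduct.one_def]

theorem sweedler_mul {ι κ : Type*} {a b : H} (r : Coalgebra.Repr k a ι)
    (s : Coalgebra.Repr k b κ) :
    sweedler B (a * b) =
      ∑ i ∈ r.index, ∑ j ∈ s.index, B (r.left i * s.left j) (r.right i * s.right j) := by
  simp [sweedler, ← r.eq, ← s.eq, Finset.sum_mul_sum]

end Sweedler

section FreeModule

variable {k : Type u} {V : Type w} [CommSemiring k] [AddCommMonoid V] [Module k V]
variable {N : Type*} [AddCommMonoid N] [Module k N] {W : Type*} [AddCommMonoid W] [Module k W]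

/-- Multiplication by the generators of `T(V)` on the free module `T(V) ⊗ N`. -/
def freeMul (k : Type u) (V : Type w) (N : Type*) [CommSemiring k] [AddCommMonoid V] [Module k V]
    [AddCommMonoid N] [Module k N] : V →ₗ[k] Module.End k (TensorAlgebra k V ⊗[k] N) :=
  LinearMap.rTensorHom N ∘ₗ LinearMap.mul k (TensorAlgebra k V) ∘ₗ TensorAlgebra.ι k

@[simp] theorem freeMul_tmul (v : V) (t : TensorAlgebra k V) (n : N) :
    freeMul k V N v (t ⊗ₜ n) = (TensorAlgebra.ι k v * t) ⊗ₜ n := by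
  simp [freeMul]

theorem free_induction {p : TensorAlgebra k V ⊗[k] N → Prop}
    (add : ∀ x y, p x → p y → p (x + y)) (one : ∀ n, p (1 ⊗ₜ n))
    (mul : ∀ v m, p m → p (freeMul k V N v m)) (m : TensorAlgebra k V ⊗[k] N) : p m := by
  induction m using TensorProduct.induction_on with
  | zero => simpa using one 0
  | add x y hx hy => exact add x y hx hy
  | tmul t n =>
    suffices h : ∀ a s : TensorAlgebra k V, (∀ n : N, p (s ⊗ₜ n)) → ∀ n : N, p ((a * s) ⊗ₜ n) by
      simpa using h t 1 one n
    intro a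
    induction a using TensorAlgebra.induction with
    | algebraMap r =>
      intro s hs n
      rw [← Algebra.smul_def, TensorProduct.smul_tmul]
      exact hs _
    | ι v =>
      intro s hs n
      rw [← freeMul_tmul]
      exact mul _ _ (hs n)
    | mul a b ha hb =>
      intro s hs n
      rw [mul_assoc]
      exact ha _ (hb _ hs) n
    | add a b ha hb =>
      intro s hs n
      rw [add_mul, TensorProduct.add_tmul]
      exact add _ _ (ha s hs n) (hb s hs n)

/-- The recursion behind `freeRec`, which carries the argument along with the value. -/
def freeRecPair (b : N →ₗ[k] W) (s : V →ₗ[k] W →ₗ[k] W)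
    (c : V →ₗ[k] TensorAlgebra k V ⊗[k] N →ₗ[k] W) :
    TensorAlgebra k V ⊗[k] N →ₗ[k] W × (TensorAlgebra k V ⊗[k] N) :=
  TensorProduct.lift
    (LinearMap.lcomp k _ (b.prod (TensorProduct.mk k (TensorAlgebra k V) N 1)) ∘ₗ
      (TensorAlgebra.lift k (A := Module.End k (W × (TensorAlgebra k V ⊗[k] N)))
        (LinearMap.mk₂ k (fun v z => (s v z.1 + c v z.2, freeMul k V N v z.2))
          (fun v v' z => by ext <;> simp [add_add_add_comm])
          (fun r v z => by ext <;> simp)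
          (fun v z z' => by ext <;> simp [add_add_add_comm])
          (fun r v z => by ext <;> simp))).toLinearMap)

/-- The linear map `F : T(V) ⊗ N → W` with `F(1 ⊗ n) = b(n)` and `F(v m) = s(v, F(m)) + c(v, m)`. -/
def freeRec (b : N →ₗ[k] W) (s : V →ₗ[k] W →ₗ[k] W)
    (c : V →ₗ[k] TensorAlgebra k V ⊗[k] N →ₗ[k] W) : TensorAlgebra k V ⊗[k] N →ₗ[k] W :=
  LinearMap.fst k _ _ ∘ₗ freeRecPair b s c

section Recursion

variable (b : N →ₗ[k] W) (s : V →ₗ[k] W →ₗ[k] W)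
  (c : V →ₗ[k] TensorAlgebra k V ⊗[k] N →ₗ[k] W)

@[simp] theorem freeRecPair_one_tmul (n : N) : freeRecPair b s c (1 ⊗ₜ n) = (b n, 1 ⊗ₜ n) := by
  simp [freeRecPair]

theorem freeRecPair_freeMul (v : V) (m : TensorAlgebra k V ⊗[k] N) :
    freeRecPair b s c (freeMul k V N v m) =
      (s v (freeRecPair b s c m).1 + c v (freeRecPair b s c m).2,
        freeMul k V N v (freeRecPair b s c m).2) := by
  induction m using TensorProduct.induction_on with
  | zero => simp only [map_zero, Prod.fst_zero, Prod.snd_zero, add_zero, Prod.mk_zero_zero]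
  | add x y hx hy => simp [hx, hy, add_add_add_comm]
  | tmul t n => simp [freeRecPair]

theorem freeRecPair_snd (m : TensorAlgebra k V ⊗[k] N) : (freeRecPair b s c m).2 = m := by
  induction m using free_induction with
  | add x y hx hy => simp [hx, hy]
  | one n => simp
  | mul v m hm => simp [freeRecPair_freeMul, hm]

@[simp] theorem freeRec_one_tmul (n : N) : freeRec b s c (1 ⊗ₜ n) = b n := by
  simp [freeRec]

@[simp] theorem freeRec_freeMul (v : V) (m : TensorAlgebra k V ⊗[k] N) :
    freeRec b s c (freeMul k V N v m) = s v (freeRec b s c m) + c v m := by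
  simp [freeRec, freeRecPair_freeMul, freeRecPair_snd]

end Recursion

end FreeModule

section Pairing

variable {k : Type u} {H : Type v} {V : Type w} [Field k] [Ring H] [Bialgebra k H]
variable [AddCommGroup V] [Module k V]

/-- The pairing `β`, as a bilinear map. -/
def pairingₗ (δ : V →ₗ[k] H ⊗[k] V) : Module.Dual k V →ₗ[k] V →ₗ[k] H :=
  LinearMap.mk₂ k (fun f v => pairing δ f v)
    (fun f f' v => by simp [pairing, LinearMap.lTensor_add])
    (fun c f v => by simp [pairing, LinearMap.lTensor_smul])
    (fun f v v' => by simp)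
    (fun c f v => by simp)

@[simp] theorem pairingₗ_apply (δ : V →ₗ[k] H ⊗[k] V) (f : Module.Dual k V) (v : V) :
    pairingₗ δ f v = pairing δ f v := rfl

theorem rid_lTensor_rTensor_mulRight (f : Module.Dual k V) (b : H) (z : H ⊗[k] V) :
    TensorProduct.rid k H (LinearMap.lTensor H f
        (LinearMap.rTensor V (LinearMap.mulRight k b) z)) =
      TensorProduct.rid k H (LinearMap.lTensor H f z) * b := by
  induction z using TensorProduct.induction_on with
  | zero => simp
  | add x y hx hy => simp only [map_add, hx, hy, add_mul]
  | tmul a v => simp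

variable [Module H V] [IsScalarTower k H V]

@[simp] theorem lact_apply (h : H) (v : V) : lact k H V h v = h • v := rfl

theorem ract_apply (h : H) (f : Module.Dual k V) (v : V) : ract k H V h f v = f (h • v) := rfl

theorem ract_one (f : Module.Dual k V) : ract k H V 1 f = f := by
  ext v; simp [ract_apply]

theorem ract_mul (a b : H) (f : Module.Dual k V) :
    ract k H V (a * b) f = ract k H V b (ract k H V a f) := by
  ext v; simp [ract_apply, mul_smul]

theorem rid_lTensor_map_mul_lact (f : Module.Dual k V) (a b : H) (z : H ⊗[k] V) :
    TensorProduct.rid k H (LinearMap.lTensor H f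
        (TensorProduct.map (TensorProduct.lift (LinearMap.mul k H))
          (TensorProduct.lift (lact k H V))
          (TensorProduct.tensorTensorTensorComm k H H H V ((a ⊗ₜ b) ⊗ₜ z)))) =
      a * TensorProduct.rid k H (LinearMap.lTensor H (ract k H V b f) z) := by
  induction z using TensorProduct.induction_on with
  | zero => simp
  | add x y hx hy => simp only [TensorProduct.tmul_add, map_add, hx, hy, mul_add]
  | tmul c v => simp [ract_apply]

theorem IsQuasiYD.sum_pairing_mul {δ : V →ₗ[k] H ⊗[k] V} (hδ : IsQuasiYD δ) (f : Module.Dual k V)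
    (v : V) {ι : Type*} {h : H} (r : Coalgebra.Repr k h ι) :
    ∑ i ∈ r.index, pairing δ f (r.left i • v) * r.right i =
      ∑ i ∈ r.index, r.left i * pairing δ (ract k H V (r.right i) f) v := by
  have hyd := congrArg (TensorProduct.rid k H ∘ LinearMap.lTensor H f) (hδ h v)
  rw [← r.eq] at hyd
  simp only [map_sum, TensorProduct.lift.tmul, LinearMap.mk₂_apply, Function.comp_apply,
    TensorProduct.sum_tmul, rid_lTensor_rTensor_mulRight, rid_lTensor_map_mul_lact] at hyd
  exact hyd

end Pairing

/-! ### Representations of the free double -/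

section Representations

variable {k : Type u} {H : Type v} {V : Type w} [Field k] [Ring H] [Bialgebra k H]
variable [AddCommGroup V] [Module k V] [Module H V] [IsScalarTower k H V]

section FreeAction

variable {N : Type x} [AddCommGroup N] [Module k N] (ρ : H →ₐ[k] Module.End k N)

/-- The linear map underlying `hAct`. -/
def hActLinear (ρ : H →ₗ[k] Module.End k N) : H →ₗ[k] Module.End k (TensorAlgebra k V ⊗[k] N) :=
  (freeRec (W := H →ₗ[k] (TensorAlgebra k V ⊗[k] N))
    (LinearMap.llcomp k H N _ (TensorProduct.mk k (TensorAlgebra k V) N 1) ∘ₗ ρ.flip)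
    (LinearMap.mk₂ k
      (fun v g => sweedler ((freeMul k V N).compl₁₂ ((lact k H V).flip v) g))
      (fun v v' g => by
        ext h; simp [sweedler_eq_sum _ (ℛ k h), Finset.sum_add_distrib])
      (fun c v g => by
        ext h; simp [sweedler_eq_sum _ (ℛ k h), Finset.smul_sum])
      (fun v g g' => by
        ext h; simp [sweedler_eq_sum _ (ℛ k h), Finset.sum_add_distrib])
      (fun c v g => by
        ext h; simp [sweedler_eq_sum _ (ℛ k h), Finset.smul_sum])) 0).flip

@[simp] theorem hActLinear_one_tmul (ρ : H →ₗ[k] Module.End k N) (h : H) (n : N) :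
    hActLinear (V := V) ρ h (1 ⊗ₜ n) = 1 ⊗ₜ ρ h n := by
  simp [hActLinear]

theorem hActLinear_freeMul (ρ : H →ₗ[k] Module.End k N) (h : H) (v : V)
    (m : TensorAlgebra k V ⊗[k] N) :
    hActLinear ρ h (freeMul k V N v m) =
      sweedler ((freeMul k V N).compl₁₂ ((lact k H V).flip v) ((hActLinear ρ).flip m)) h := by
  simp [hActLinear, LinearMap.flip_flip]

theorem hActLinear_one (m : TensorAlgebra k V ⊗[k] N) : hActLinear ρ.toLinearMap 1 m = m := by
  induction m using free_induction with
  | add x y hx hy => simp [hx, hy]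
  | one n => simp
  | mul v m hm => simp [hActLinear_freeMul, sweedler_one, hm]

theorem hActLinear_mul (a b : H) (m : TensorAlgebra k V ⊗[k] N) :
    hActLinear ρ.toLinearMap (a * b) m =
      hActLinear ρ.toLinearMap a (hActLinear ρ.toLinearMap b m) := by
  induction m using free_induction generalizing a b with
  | add x y hx hy => simp [hx, hy]
  | one n => simp
  | mul v m hm =>
    simp_rw [hActLinear_freeMul _ (a * b), hActLinear_freeMul _ b, sweedler_mul _ (ℛ k a) (ℛ k b),
      sweedler_eq_sum _ (ℛ k b), map_sum, LinearMap.compl₁₂_apply, LinearMap.flip_apply,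
      hActLinear_freeMul, sweedler_eq_sum _ (ℛ k a)]
    rw [Finset.sum_comm]
    simp [hm, mul_smul]

/-- The action of `H` on `T(V) ⊗ N` with `h (v m) = (h₍₁₎ ▷ v) (h₍₂₎ m)` which extends an action
of `H` on `N`. -/
def hAct : H →ₐ[k] Module.End k (TensorAlgebra k V ⊗[k] N) :=
  AlgHom.ofLinearMap (hActLinear ρ.toLinearMap) (LinearMap.ext (hActLinear_one ρ))
    fun a b => LinearMap.ext (hActLinear_mul ρ a b)

@[simp] theorem hAct_one_tmul (h : H) (n : N) : hAct (V := V) ρ h (1 ⊗ₜ n) = 1 ⊗ₜ ρ h n :=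
  hActLinear_one_tmul _ h n

theorem hAct_freeMul {ι : Type*} {h : H} (r : Coalgebra.Repr k h ι) (v : V)
    (m : TensorAlgebra k V ⊗[k] N) :
    hAct ρ h (freeMul k V N v m) =
      ∑ i ∈ r.index, freeMul k V N (r.left i • v) (hAct ρ (r.right i) m) :=
  (hActLinear_freeMul _ h v m).trans (sweedler_eq_sum _ r)

variable (δ : V →ₗ[k] H ⊗[k] V) (σ : Module.Dual k V →ₗ[k] Module.End k N)

/-- The operators of `V*` on `T(V) ⊗ N` with `f (v m) = v (f m) + β(f, v) m` which extend given
operators on `N`. -/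
def fAct : Module.Dual k V →ₗ[k] Module.End k (TensorAlgebra k V ⊗[k] N) :=
  (freeRec (W := Module.Dual k V →ₗ[k] (TensorAlgebra k V ⊗[k] N))
    (LinearMap.llcomp k _ N _ (TensorProduct.mk k (TensorAlgebra k V) N 1) ∘ₗ σ.flip)
    (LinearMap.llcomp k _ _ _ ∘ₗ freeMul k V N)
    ((LinearMap.mk₂ k (fun v m => (hAct ρ).toLinearMap.flip m ∘ₗ (pairingₗ δ).flip v)
      (fun v v' m => by ext; simp) (fun c v m => by ext; simp)
      (fun v m m' => by ext; simp) (fun c v m => by ext; simp)))).flip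

@[simp] theorem fAct_one_tmul (f : Module.Dual k V) (n : N) :
    fAct ρ δ σ f (1 ⊗ₜ n) = 1 ⊗ₜ σ f n := by
  simp [fAct]

theorem fAct_freeMul (f : Module.Dual k V) (v : V) (m : TensorAlgebra k V ⊗[k] N) :
    fAct ρ δ σ f (freeMul k V N v m) =
      freeMul k V N v (fAct ρ δ σ f m) + hAct ρ (pairing δ f v) m := by
  simp [fAct]

theorem fAct_hAct {δ : V →ₗ[k] H ⊗[k] V} (hδ : IsQuasiYD δ)
    (hσ : ∀ f h n, σ f (ρ h n) =
      ∑ i ∈ (ℛ k h).index, ρ ((ℛ k h).left i) (σ (ract k H V ((ℛ k h).right i) f) n))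
    (f : Module.Dual k V) (h : H) (m : TensorAlgebra k V ⊗[k] N) :
    fAct ρ δ σ f (hAct ρ h m) = ∑ i ∈ (ℛ k h).index,
      hAct ρ ((ℛ k h).left i) (fAct ρ δ σ (ract k H V ((ℛ k h).right i) f) m) := by
  induction m using free_induction generalizing h f with
  | add x y hx hy => simp only [map_add, hx, hy, Finset.sum_add_distrib]
  | one n => simp only [hAct_one_tmul, fAct_one_tmul, hσ, TensorProduct.tmul_sum]
  | mul v m hm =>
    let φ : H →ₗ[k] H →ₗ[k] H →ₗ[k] (TensorAlgebra k V ⊗[k] N) :=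
      LinearMap.mk₂ k (fun a b => freeMul k V N (a • v) ∘ₗ hAct ρ b ∘ₗ (fAct ρ δ σ).flip m ∘ₗ
          (ract k H V).flip f)
        (fun a a' b => by ext; simp [add_smul]) (fun c a b => by ext; simp)
        (fun a b b' => by ext; simp) (fun c a b => by ext; simp)
    have coassoc := sum_sum_coassoc φ (ℛ k h) (fun i => ℛ k _) (fun i => ℛ k _)
    have yetterDrinfeld := congrArg (fun x => hAct ρ x m) (hδ.sum_pairing_mul f v (ℛ k h))
    simp only [map_sum, map_mul, LinearMap.sum_apply, Module.End.mul_apply] at yetterDrinfeld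
    simp only [hAct_freeMul ρ (ℛ k h), map_sum, fAct_freeMul, Finset.sum_add_distrib, map_add,
      yetterDrinfeld, hm, hAct_freeMul ρ (ℛ k ((ℛ k h).left _))]
    simpa [φ] using coassoc.symm

end FreeAction

section UniversalProperty

variable (δ : V →ₗ[k] H ⊗[k] V)

/-- Maps from `V`, `H` and `V*` to an algebra `A` which satisfy the defining relations of
`Ã(V, δ)`. -/
structure Realization (A : Type*) [Ring A] [Algebra k A] where
  toV : V →ₗ[k] A
  toH : H →ₐ[k] A
  toF : Module.Dual k V →ₗ[k] A
  toH_mul_toV (h : H) (v : V) : toH h * toV v =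
    ∑ i ∈ (ℛ k h).index, toV ((ℛ k h).left i • v) * toH ((ℛ k h).right i)
  toF_mul_toH (f : Module.Dual k V) (h : H) : toF f * toH h =
    ∑ i ∈ (ℛ k h).index, toH ((ℛ k h).left i) * toF (ract k H V ((ℛ k h).right i) f)
  toF_mul_toV (f : Module.Dual k V) (v : V) : toF f * toV v = toV v * toF f + toH (pairing δ f v)

variable {δ} {A : Type*} [Ring A] [Algebra k A]

/-- The homomorphism from `Ã(V, δ)` given by its universal property. -/
def Realization.lift (R : Realization δ A) : FreeDouble δ →ₐ[k] A :=
  RingQuot.liftAlgHom k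
    ⟨TensorAlgebra.lift k (R.toV.coprod (R.toH.toLinearMap.coprod R.toF)), by
      intro x y hxy
      induction hxy with
      | one => simp [preH]
      | mul x y => simp [preH]
      | left h v =>
        rw [← (ℛ k h).eq]
        simp [preH, preV, R.toH_mul_toV]
      | right f h =>
        rw [← (ℛ k h).eq]
        simp [preH, preF, R.toF_mul_toH]
      | comm f v => simp [preH, preV, preF, R.toF_mul_toV]⟩

variable (R : Realization δ A)

@[simp] theorem Realization.lift_incV_ι (v : V) :
    R.lift (incV δ (TensorAlgebra.ι k v)) = R.toV v := by
  simp [lift, incV, preV]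

@[simp] theorem Realization.lift_incH (h : H) : R.lift (incH δ h) = R.toH h := by
  simp [lift, incH, preH]

@[simp] theorem Realization.lift_incF_ι (f : Module.Dual k V) :
    R.lift (incF δ (TensorAlgebra.ι k f)) = R.toF f := by
  simp [lift, incF, preF]

/-- The operators of `V`, `H` and `V*` on the free module `T(V) ⊗ N`. -/
@[simps] def freeRealization (hδ : IsQuasiYD δ) {N : Type x} [AddCommGroup N] [Module k N]
    (ρ : H →ₐ[k] Module.End k N) (σ : Module.Dual k V →ₗ[k] Module.End k N)
    (hσ : ∀ f h n, σ f (ρ h n) =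
      ∑ i ∈ (ℛ k h).index, ρ ((ℛ k h).left i) (σ (ract k H V ((ℛ k h).right i) f) n)) :
    Realization δ (Module.End k (TensorAlgebra k V ⊗[k] N)) where
  toV := freeMul k V N
  toH := hAct ρ
  toF := fAct ρ δ σ
  toH_mul_toV h v := LinearMap.ext fun m => by simpa using hAct_freeMul ρ (ℛ k h) v m
  toF_mul_toH f h := LinearMap.ext fun m => by simpa using fAct_hAct ρ σ hδ hσ f h m
  toF_mul_toV f v := LinearMap.ext fun m => by simpa using fAct_freeMul ρ δ σ f v m

end UniversalProperty

section Relations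

variable (δ : V →ₗ[k] H ⊗[k] V)

theorem incV_ι (v : V) : incV δ (TensorAlgebra.ι k v) =
    RingQuot.mkAlgHom k (Rel δ) (preV k H V v) := by
  simp [incV]

theorem incF_ι (f : Module.Dual k V) : incF δ (TensorAlgebra.ι k f) =
    RingQuot.mkAlgHom k (Rel δ) (preF k H V f) := by
  simp [incF]

@[simp] theorem incH_one : incH δ 1 = 1 := by
  simpa [incH] using RingQuot.mkAlgHom_rel k (Rel.one (δ := δ))

theorem incH_mul (a b : H) : incH δ (a * b) = incH δ a * incH δ b := by
  simpa [incH] using RingQuot.mkAlgHom_rel k (Rel.mul (δ := δ) a b)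

theorem incH_mul_incV_ι {ι : Type*} {h : H} (r : Coalgebra.Repr k h ι) (v : V) :
    incH δ h * incV δ (TensorAlgebra.ι k v) =
      ∑ i ∈ r.index, incV δ (TensorAlgebra.ι k (r.left i • v)) * incH δ (r.right i) := by
  have hrel := RingQuot.mkAlgHom_rel k (Rel.left (δ := δ) h v)
  rw [← r.eq] at hrel
  simpa [incV_ι, incH] using hrel

theorem incF_ι_mul_incH {ι : Type*} {h : H} (r : Coalgebra.Repr k h ι) (f : Module.Dual k V) :
    incF δ (TensorAlgebra.ι k f) * incH δ h =
      ∑ i ∈ r.index,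
        incH δ (r.left i) * incF δ (TensorAlgebra.ι k (ract k H V (r.right i) f)) := by
  have hrel := RingQuot.mkAlgHom_rel k (Rel.right (δ := δ) f h)
  rw [← r.eq] at hrel
  simpa [incF_ι, incH] using hrel

theorem incF_ι_mul_incV_ι (f : Module.Dual k V) (v : V) :
    incF δ (TensorAlgebra.ι k f) * incV δ (TensorAlgebra.ι k v) =
      incV δ (TensorAlgebra.ι k v) * incF δ (TensorAlgebra.ι k f) + incH δ (pairing δ f v) := by
  have hrel := RingQuot.mkAlgHom_rel k (Rel.comm (δ := δ) f v)
  rw [map_sub, map_mul, map_mul, ← incV_ι, ← incF_ι, sub_eq_iff_eq_add'] at hrel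
  exact hrel

variable {δ}

@[elab_as_elim]
theorem freeDouble_induction {p : FreeDouble δ → Prop}
    (add : ∀ x y, p x → p y → p (x + y)) (scalar : ∀ c : k, p (algebraMap k _ c))
    (mul : ∀ x y, p x → p y → p (x * y)) (incV_ι : ∀ v, p (incV δ (TensorAlgebra.ι k v)))
    (incH : ∀ h, p (incH δ h)) (incF_ι : ∀ f, p (incF δ (TensorAlgebra.ι k f)))
    (a : FreeDouble δ) : p a := by
  obtain ⟨a, rfl⟩ := RingQuot.mkAlgHom_surjective k (Rel δ) a
  induction a using TensorAlgebra.induction with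
  | algebraMap r => simpa using scalar r
  | ι z =>
    obtain ⟨v, h, f⟩ := z
    have hsum : TensorAlgebra.ι k (v, h, f) = preV k H V v + (preH k H V h + preF k H V f) := by
      simp [preV, preH, preF, ← map_add]
    rw [hsum, map_add, map_add, ← BraidedDouble.incV_ι, ← BraidedDouble.incF_ι]
    exact add _ _ (incV_ι v) (add _ _ (incH h) (incF_ι f))
  | mul a b ha hb => rw [map_mul]; exact mul _ _ ha hb
  | add a b ha hb => rw [map_add]; exact add _ _ ha hb

end Relations

end Representations

/-! ### Triangular decomposition -/

section Decomposition

variable {k : Type u} {H : Type v} {V : Type w} [Field k] [Ring H] [Bialgebra k H]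
variable [AddCommGroup V] [Module k V]

section PlusHalf

/-- The space `H ⊗ T(V*)`. -/
abbrev PlusHalf (k : Type u) (H : Type v) (V : Type w) [Field k] [Ring H] [Bialgebra k H]
    [AddCommGroup V] [Module k V] :=
  H ⊗[k] TensorAlgebra k (Module.Dual k V)

/-- Left multiplication by `H` on `H ⊗ T(V*)`. -/
def plusH (k : Type u) (H : Type v) (V : Type w) [Field k] [Ring H] [Bialgebra k H]
    [AddCommGroup V] [Module k V] : H →ₐ[k] Module.End k (PlusHalf k H V) :=
  (Module.End.rTensorAlgHom (R := k) (M := H) _).comp (Algebra.lmul k H)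

@[simp] theorem plusH_tmul (h x : H) (s : TensorAlgebra k (Module.Dual k V)) :
    plusH k H V h (x ⊗ₜ s) = (h * x) ⊗ₜ s := rfl

variable [Module H V] [IsScalarTower k H V]

/-- The operators `f (x ⊗ s) = x₍₁₎ ⊗ (f ◁ x₍₂₎) s` of `V*` on `H ⊗ T(V*)`. -/
def plusF (k : Type u) (H : Type v) (V : Type w) [Field k] [Ring H] [Bialgebra k H]
    [AddCommGroup V] [Module k V] [Module H V] [IsScalarTower k H V] :
    Module.Dual k V →ₗ[k] Module.End k (PlusHalf k H V) where
  toFun f := LinearMap.lTensor H (TensorProduct.lift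
      (LinearMap.mul k _ ∘ₗ TensorAlgebra.ι k ∘ₗ (ract k H V).flip f)) ∘ₗ
    (TensorProduct.assoc k H H _).toLinearMap ∘ₗ LinearMap.rTensor _ Coalgebra.comul
  map_add' f f' := by
    refine TensorProduct.ext' fun x s => ?_
    simp [← (ℛ k x).eq, TensorProduct.sum_tmul, TensorProduct.tmul_add,
      Finset.sum_add_distrib]
  map_smul' c f := by
    refine TensorProduct.ext' fun x s => ?_
    simp [← (ℛ k x).eq, TensorProduct.sum_tmul, Finset.smul_sum]

theorem plusF_tmul (f : Module.Dual k V) {ι : Type*} {x : H} (r : Coalgebra.Repr k x ι)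
    (s : TensorAlgebra k (Module.Dual k V)) :
    plusF k H V f (x ⊗ₜ s) =
      ∑ i ∈ r.index, r.left i ⊗ₜ (TensorAlgebra.ι k (ract k H V (r.right i) f) * s) := by
  simp [plusF, ← r.eq, TensorProduct.sum_tmul]

theorem plusF_one_tmul (f : Module.Dual k V) (s : TensorAlgebra k (Module.Dual k V)) :
    plusF k H V f (1 ⊗ₜ s) = 1 ⊗ₜ (TensorAlgebra.ι k f * s) := by
  simp [plusF, Algebra.TensorProduct.one_def, ract_one]

theorem plusF_plusH {ι : Type*} {h : H} (r : Coalgebra.Repr k h ι) (f : Module.Dual k V)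
    (n : PlusHalf k H V) :
    plusF k H V f (plusH k H V h n) =
      ∑ i ∈ r.index, plusH k H V (r.left i) (plusF k H V (ract k H V (r.right i) f) n) := by
  induction n using TensorProduct.induction_on with
  | zero => simp
  | add x y hx hy => simp only [map_add, hx, hy, Finset.sum_add_distrib]
  | tmul x s =>
    have hcomul : Coalgebra.comul (R := k) (h * x) = ∑ i ∈ r.index, ∑ j ∈ (ℛ k x).index,
        (r.left i * (ℛ k x).left j) ⊗ₜ[k] (r.right i * (ℛ k x).right j) := by
      rw [Bialgebra.comul_mul, ← r.eq, ← (ℛ k x).eq, Finset.sum_mul_sum]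
      simp only [Algebra.TensorProduct.tmul_mul_tmul]
    simp only [plusF_tmul _ (ℛ k x), map_sum, plusH_tmul]
    simp [plusF, hcomul, TensorProduct.sum_tmul, ract_mul]

end PlusHalf

section NormalForm

variable [Module H V] [IsScalarTower k H V]

/-- The space `T(V) ⊗ (H ⊗ T(V*))` of normal forms of elements of `Ã(V, δ)`. -/
abbrev NormalForm (k : Type u) (H : Type v) (V : Type w) [Field k] [Ring H] [Bialgebra k H]
    [AddCommGroup V] [Module k V] :=
  TensorAlgebra k V ⊗[k] PlusHalf k H V

variable {δ : V →ₗ[k] H ⊗[k] V} (hδ : IsQuasiYD δ)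

/-- The action of `Ã(V, δ)` on `T(V) ⊗ (H ⊗ T(V*))`. -/
def normalRep : FreeDouble δ →ₐ[k] Module.End k (NormalForm k H V) :=
  (freeRealization hδ (plusH k H V) (plusF k H V) fun f h n => plusF_plusH (ℛ k h) f n).lift

theorem normalRep_incV (t t' : TensorAlgebra k V) (n : PlusHalf k H V) :
    normalRep hδ (incV δ t) (t' ⊗ₜ n) = (t * t') ⊗ₜ n := by
  induction t using TensorAlgebra.induction generalizing t' with
  | algebraMap r => simp [TensorProduct.smul_tmul', Algebra.smul_def]
  | ι v => simp [normalRep]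
  | mul a b ha hb => simp [ha, hb, mul_assoc]
  | add a b ha hb => simp [ha, hb, add_mul, TensorProduct.add_tmul]

theorem normalRep_incH (h : H) (n : PlusHalf k H V) :
    normalRep hδ (incH δ h) (1 ⊗ₜ n) = 1 ⊗ₜ plusH k H V h n := by
  simp [normalRep]

theorem normalRep_incF (s s' : TensorAlgebra k (Module.Dual k V)) :
    normalRep hδ (incF δ s) (1 ⊗ₜ (1 ⊗ₜ s')) = 1 ⊗ₜ (1 ⊗ₜ (s * s')) := by
  induction s using TensorAlgebra.induction generalizing s' with
  | algebraMap r =>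
    rw [AlgHom.commutes, AlgHom.commutes, Module.algebraMap_end_apply, ← Algebra.smul_def,
      TensorProduct.tmul_smul, TensorProduct.tmul_smul]
  | ι f => simp [normalRep, plusF_one_tmul]
  | mul a b ha hb => simp [ha, hb, mul_assoc]
  | add a b ha hb => simp [ha, hb, add_mul, TensorProduct.tmul_add]

/-- The normal form of an element of `Ã(V, δ)`: the inverse of multiplication
`T(V) ⊗ H ⊗ T(V*) → Ã(V, δ)`. -/
def toNormal : FreeDouble δ →ₗ[k] NormalForm k H V :=
  LinearMap.applyₗ (1 ⊗ₜ (1 ⊗ₜ 1)) ∘ₗ (normalRep hδ).toLinearMap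

@[simp] theorem toNormal_mul_mul (t : TensorAlgebra k V) (h : H)
    (s : TensorAlgebra k (Module.Dual k V)) :
    toNormal hδ (incV δ t * incH δ h * incF δ s) = t ⊗ₜ (h ⊗ₜ s) := by
  simp [toNormal, normalRep_incF, normalRep_incH, normalRep_incV]

end NormalForm

section TensorAlgebraHom

variable {A : Type*} [Ring A] [Algebra k A] (φ : TensorAlgebra k V →ₐ[k] A)

theorem range_mul_range : LinearMap.range φ.toLinearMap * LinearMap.range φ.toLinearMap =
    LinearMap.range φ.toLinearMap :=
  φ.range.isIdempotentElem_toSubmodule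

theorem one_le_range : 1 ≤ LinearMap.range φ.toLinearMap :=
  Submodule.one_le.2 ⟨1, map_one φ⟩

theorem mul_range_le_range_mul {Q : Submodule k A}
    (hQ : ∀ q ∈ Q, ∀ v, q * φ (TensorAlgebra.ι k v) ∈ LinearMap.range φ.toLinearMap * Q) :
    Q * LinearMap.range φ.toLinearMap ≤ LinearMap.range φ.toLinearMap * Q := by
  rw [Submodule.mul_le]
  rintro q hq _ ⟨t, rfl⟩
  induction t using TensorAlgebra.induction generalizing q with
  | algebraMap r =>
    rw [AlgHom.toLinearMap_apply, AlgHom.commutes, ← Algebra.commutes, ← φ.commutes]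
    exact Submodule.mul_mem_mul ⟨_, rfl⟩ hq
  | ι v => exact hQ q hq v
  | add a b ha hb => simpa [mul_add] using add_mem (ha q hq) (hb q hq)
  | mul a b ha hb =>
    suffices h : ∀ x ∈ LinearMap.range φ.toLinearMap * Q,
        x * φ b ∈ LinearMap.range φ.toLinearMap * Q by
      simpa [mul_assoc] using h _ (ha q hq)
    intro x hx
    induction hx using Submodule.mul_induction_on' with
    | mem_mul_mem p hp q hq =>
      rw [mul_assoc, ← range_mul_range φ, mul_assoc]
      exact Submodule.mul_mem_mul hp (hb q hq)
    | add x _ y _ hx hy => simpa [add_mul] using add_mem hx hy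

end TensorAlgebraHom

section Spanning

variable [Module H V] [IsScalarTower k H V]
variable (δ : V →ₗ[k] H ⊗[k] V)

/-- The image of `T(V)` in `Ã(V, δ)`. -/
abbrev rangeV : Submodule k (FreeDouble δ) := LinearMap.range (incV δ).toLinearMap

/-- The image of `H` in `Ã(V, δ)`. -/
abbrev rangeH : Submodule k (FreeDouble δ) := LinearMap.range (incH δ)

/-- The image of `T(V*)` in `Ã(V, δ)`. -/
abbrev rangeF : Submodule k (FreeDouble δ) := LinearMap.range (incF δ).toLinearMap

theorem incV_mem_rangeV (t : TensorAlgebra k V) : incV δ t ∈ rangeV δ := ⟨t, rfl⟩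

theorem incH_mem_rangeH (h : H) : incH δ h ∈ rangeH δ := ⟨h, rfl⟩

theorem incF_mem_rangeF (s : TensorAlgebra k (Module.Dual k V)) : incF δ s ∈ rangeF δ := ⟨s, rfl⟩

theorem one_le_rangeH : 1 ≤ rangeH δ :=
  Submodule.one_le.2 ⟨1, incH_one δ⟩

theorem rangeH_mul_rangeH : rangeH δ * rangeH δ = rangeH δ := by
  refine le_antisymm (Submodule.mul_le.2 ?_) (le_mul_of_one_le_left' (one_le_rangeH δ))
  rintro _ ⟨a, rfl⟩ _ ⟨b, rfl⟩
  exact ⟨a * b, incH_mul δ a b⟩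

theorem incH_mul_incV_ι_mem (h : H) (v : V) :
    incH δ h * incV δ (TensorAlgebra.ι k v) ∈ rangeV δ * rangeH δ := by
  rw [incH_mul_incV_ι δ (ℛ k h)]
  exact sum_mem fun i _ => Submodule.mul_mem_mul ⟨_, rfl⟩ ⟨_, rfl⟩

/-- The image of `H ⊕ V*` in `Ã(V, δ)`; unlike `V*`, it can be moved to the right past `T(V)`. -/
abbrev rangeHF : Submodule k (FreeDouble δ) :=
  rangeH δ ⊔ LinearMap.range ((incF δ).toLinearMap ∘ₗ TensorAlgebra.ι k)

theorem rangeHF_mul_rangeV_le : rangeHF δ * rangeV δ ≤ rangeV δ * rangeHF δ := by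
  refine mul_range_le_range_mul _ fun q hq v => ?_
  obtain ⟨_, ⟨h, rfl⟩, _, ⟨f, rfl⟩, rfl⟩ := Submodule.mem_sup.1 hq
  rw [add_mul]
  refine add_mem (mul_le_mul_right le_sup_left (rangeV δ) (incH_mul_incV_ι_mem δ h v)) ?_
  rw [LinearMap.comp_apply, AlgHom.toLinearMap_apply, incF_ι_mul_incV_ι]
  refine add_mem (Submodule.mul_mem_mul ⟨_, rfl⟩ (Submodule.mem_sup_right ⟨f, rfl⟩)) ?_
  simpa using Submodule.mul_mem_mul (Submodule.one_le.1 (one_le_range (incV δ)))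
    (Submodule.mem_sup_left (incH_mem_rangeH δ (pairing δ f v)))

theorem rangeHF_mul_rangeH_le : rangeHF δ * rangeH δ ≤ rangeH δ * rangeF δ := by
  rw [Submodule.sup_mul, rangeH_mul_rangeH, sup_le_iff]
  refine ⟨le_mul_of_one_le_right' (one_le_range _), Submodule.mul_le.2 ?_⟩
  rintro _ ⟨f, rfl⟩ _ ⟨h, rfl⟩
  rw [LinearMap.comp_apply, AlgHom.toLinearMap_apply, incF_ι_mul_incH δ (ℛ k h)]
  exact sum_mem fun i _ => Submodule.mul_mem_mul ⟨_, rfl⟩ ⟨_, rfl⟩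

theorem rangeHF_mul_le : rangeHF δ * (rangeV δ * rangeH δ * rangeF δ) ≤
    rangeV δ * rangeH δ * rangeF δ :=
  calc rangeHF δ * (rangeV δ * rangeH δ * rangeF δ)
      = rangeHF δ * rangeV δ * rangeH δ * rangeF δ := by simp only [mul_assoc]
    _ ≤ rangeV δ * rangeHF δ * rangeH δ * rangeF δ := by
      grw [rangeHF_mul_rangeV_le]
    _ = rangeV δ * (rangeHF δ * rangeH δ) * rangeF δ := by simp only [mul_assoc]
    _ ≤ rangeV δ * (rangeH δ * rangeF δ) * rangeF δ := by
      grw [rangeHF_mul_rangeH_le]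
    _ = rangeV δ * rangeH δ * rangeF δ := by
      rw [mul_assoc, mul_assoc, range_mul_range, ← mul_assoc]

theorem rangeV_mul_rangeH_mul_rangeF : rangeV δ * rangeH δ * rangeF δ = ⊤ := by
  refine Submodule.eq_top_iff'.2 fun a => ?_
  suffices h : ∀ x ∈ rangeV δ * rangeH δ * rangeF δ,
      a * x ∈ rangeV δ * rangeH δ * rangeF δ by
    have one_le : 1 ≤ rangeV δ * rangeH δ * rangeF δ :=
      one_le_mul (one_le_mul (one_le_range _) (one_le_rangeH δ)) (one_le_range _)
    simpa using h 1 (Submodule.one_le.1 one_le)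
  induction a using freeDouble_induction with
  | add a b ha hb => intro x hx; simpa [add_mul] using add_mem (ha x hx) (hb x hx)
  | scalar c => intro x hx; simpa [← Algebra.smul_def] using Submodule.smul_mem _ c hx
  | mul a b ha hb => intro x hx; simpa [mul_assoc] using ha _ (hb x hx)
  | incV_ι v =>
    intro x hx
    have hmem := Submodule.mul_mem_mul (incV_mem_rangeV δ (TensorAlgebra.ι k v)) hx
    rwa [← mul_assoc, ← mul_assoc, range_mul_range] at hmem
  | incH h =>
    intro x hx
    exact rangeHF_mul_le δ (Submodule.mul_mem_mul (Submodule.mem_sup_left ⟨h, rfl⟩) hx)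
  | incF_ι f =>
    intro x hx
    exact rangeHF_mul_le δ (Submodule.mul_mem_mul (Submodule.mem_sup_right ⟨f, rfl⟩) hx)

variable {δ}

@[elab_as_elim]
theorem normal_induction {p : FreeDouble δ → Prop} (add : ∀ x y, p x → p y → p (x + y))
    (mul : ∀ t h s, p (incV δ t * incH δ h * incF δ s)) (a : FreeDouble δ) : p a := by
  have ha : a ∈ rangeV δ * rangeH δ * rangeF δ := by
    rw [rangeV_mul_rangeH_mul_rangeF]; trivial
  refine Submodule.mul_induction_on ha ?_ add
  rintro x hx _ ⟨s, rfl⟩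
  refine Submodule.mul_induction_on hx ?_ fun x y hx hy => add_mul x y _ ▸ add _ _ hx hy
  rintro _ ⟨t, rfl⟩ _ ⟨h, rfl⟩
  exact mul t h s

end Spanning

end Decomposition

/-! ### Triangular ideals and minimal doubles -/

section Triangularity

variable {k : Type u} {H : Type v} {V : Type w} [Field k] [Ring H] [Bialgebra k H]
variable [AddCommGroup V] [Module k V] [Module H V] [IsScalarTower k H V]
variable {δ : V →ₗ[k] H ⊗[k] V} (hδ : IsQuasiYD δ)

section Projections

variable (g : Module.Dual k H)

/-- The projection `t ⊗ h ⊗ s ↦ g(h) ε(s) t` of `Ã(V, δ)` onto `T(V)`. -/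
def projV : FreeDouble δ →ₗ[k] TensorAlgebra k V :=
  (TensorProduct.rid k _).toLinearMap ∘ₗ LinearMap.lTensor _ (LinearMap.mul' k k ∘ₗ
    TensorProduct.map g (TensorAlgebra.algebraMapInv (R := k) (M := Module.Dual k V)).toLinearMap)
    ∘ₗ toNormal hδ

/-- The projection `t ⊗ h ⊗ s ↦ ε(t) g(h) s` of `Ã(V, δ)` onto `T(V*)`. -/
def projF : FreeDouble δ →ₗ[k] TensorAlgebra k (Module.Dual k V) :=
  (TensorProduct.lid k _).toLinearMap ∘ₗ
    TensorProduct.map (TensorAlgebra.algebraMapInv (R := k) (M := V)).toLinearMap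
      ((TensorProduct.lid k _).toLinearMap ∘ₗ LinearMap.rTensor _ g) ∘ₗ toNormal hδ

@[simp] theorem projV_mul_mul (t : TensorAlgebra k V) (h : H)
    (s : TensorAlgebra k (Module.Dual k V)) :
    projV hδ g (incV δ t * incH δ h * incF δ s) =
      (g h * TensorAlgebra.algebraMapInv s) • t := by
  simp [projV]

@[simp] theorem projF_mul_mul (t : TensorAlgebra k V) (h : H)
    (s : TensorAlgebra k (Module.Dual k V)) :
    projF hδ g (incV δ t * incH δ h * incF δ s) =
      (TensorAlgebra.algebraMapInv t * g h) • s := by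
  simpa [projF, mul_smul] using smul_comm _ _ _

theorem projV_incV_mul_incH (t : TensorAlgebra k V) (h : H) :
    projV hδ g (incV δ t * incH δ h) = g h • t := by
  simpa using projV_mul_mul hδ g t h 1

theorem projF_incH_mul_incF (h : H) (s : TensorAlgebra k (Module.Dual k V)) :
    projF hδ g (incH δ h * incF δ s) = g h • s := by
  simpa using projF_mul_mul hδ g 1 h s

theorem projV_incV (t : TensorAlgebra k V) :
    projV hδ (Coalgebra.counit (R := k) (A := H)) (incV δ t) = t := by
  simpa using projV_incV_mul_incH hδ (Coalgebra.counit (R := k) (A := H)) t 1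

theorem projF_incF (s : TensorAlgebra k (Module.Dual k V)) :
    projF hδ (Coalgebra.counit (R := k) (A := H)) (incF δ s) = s := by
  simpa using projF_incH_mul_incF hδ (Coalgebra.counit (R := k) (A := H)) 1 s

end Projections

section TriangularForm

variable (δ) in
/-- The subspace `I⁻ ⊗ H ⊗ T(V*) + T(V) ⊗ H ⊗ I⁺` of `Ã(V, δ)`. -/
def triangularForm (Im : Submodule k (TensorAlgebra k V))
    (Ip : Submodule k (TensorAlgebra k (Module.Dual k V))) : Submodule k (FreeDouble δ) :=
  Im.map (incV δ).toLinearMap * rangeH δ * rangeF δ ⊔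
    rangeV δ * rangeH δ * Ip.map (incF δ).toLinearMap

variable {Im Im' : Submodule k (TensorAlgebra k V)}
variable {Ip Ip' : Submodule k (TensorAlgebra k (Module.Dual k V))}

theorem mul_mem_triangularForm_left {t : TensorAlgebra k V} (ht : t ∈ Im) (h : H)
    (s : TensorAlgebra k (Module.Dual k V)) :
    incV δ t * incH δ h * incF δ s ∈ triangularForm δ Im Ip :=
  Submodule.mem_sup_left <| Submodule.mul_mem_mul
    (Submodule.mul_mem_mul (Submodule.mem_map_of_mem ht) (incH_mem_rangeH δ h))
    (incF_mem_rangeF δ s)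

theorem mul_mem_triangularForm_right (t : TensorAlgebra k V) (h : H)
    {s : TensorAlgebra k (Module.Dual k V)} (hs : s ∈ Ip) :
    incV δ t * incH δ h * incF δ s ∈ triangularForm δ Im Ip :=
  Submodule.mem_sup_right <| Submodule.mul_mem_mul
    (Submodule.mul_mem_mul (incV_mem_rangeV δ t) (incH_mem_rangeH δ h))
    (Submodule.mem_map_of_mem hs)

theorem mul_mul_le {R A : Type*} [CommSemiring R] [Semiring A] [Algebra R A]
    {M N P S : Submodule R A} (h : ∀ a ∈ M, ∀ b ∈ N, ∀ c ∈ P, a * b * c ∈ S) : M * N * P ≤ S :=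
  Submodule.mul_le.2 fun m hm c hc => Submodule.mul_induction_on hm
    (fun a ha b hb => h a ha b hb c hc)
    (fun x y hx hy => by rw [add_mul]; exact add_mem hx hy)

theorem triangularForm_le {S : Submodule k (FreeDouble δ)}
    (hm : ∀ t ∈ Im, ∀ h s, incV δ t * incH δ h * incF δ s ∈ S)
    (hp : ∀ t h, ∀ s ∈ Ip, incV δ t * incH δ h * incF δ s ∈ S) :
    triangularForm δ Im Ip ≤ S := by
  refine sup_le (mul_mul_le ?_) (mul_mul_le ?_)
  · rintro _ ⟨t, ht, rfl⟩ _ ⟨h, rfl⟩ _ ⟨s, rfl⟩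
    exact hm t ht h s
  · rintro _ ⟨t, rfl⟩ _ ⟨h, rfl⟩ _ ⟨s, hs, rfl⟩
    exact hp t h s hs

theorem triangularForm_mono (hm : Im ≤ Im') (hp : Ip ≤ Ip') :
    triangularForm δ Im Ip ≤ triangularForm δ Im' Ip' := by
  unfold triangularForm
  gcongr

end TriangularForm

section TriangularIdeals

variable {Im : Submodule k (TensorAlgebra k V)}
variable {Ip : Submodule k (TensorAlgebra k (Module.Dual k V))}
variable {J : Ideal (FreeDouble δ)}

theorem HasTriangularForm.mk_of_le (twoSided : J.IsTwoSided) (minus_le : Im ≤ posPart k V)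
    (plus_le : Ip ≤ posPart k (Module.Dual k V)) (hm : ∀ t ∈ Im, incV δ t ∈ J)
    (hp : ∀ s ∈ Ip, incF δ s ∈ J) (hJ : J.restrictScalars k ≤ triangularForm δ Im Ip) :
    HasTriangularForm δ J Im Ip where
  twoSided := twoSided
  minus_le := minus_le
  plus_le := plus_le
  eq := le_antisymm hJ <| triangularForm_le (S := J.restrictScalars k)
    (fun _ ht _ _ => J.mul_mem_right _ (J.mul_mem_right _ (hm _ ht)))
    (fun _ _ _ hs => J.mul_mem_left _ (hp _ hs))

namespace HasTriangularForm

variable (hJ : HasTriangularForm δ J Im Ip)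
include hJ

theorem restrictScalars_le : J.restrictScalars k ≤ triangularForm δ Im Ip := hJ.eq.le

theorem incV_mem {t : TensorAlgebra k V} (ht : t ∈ Im) : incV δ t ∈ J := by
  have h : incV δ t * incH δ 1 * incF δ 1 ∈ J.restrictScalars k :=
    hJ.eq.ge (mul_mem_triangularForm_left ht 1 1)
  simpa using h

theorem incF_mem {s : TensorAlgebra k (Module.Dual k V)} (hs : s ∈ Ip) : incF δ s ∈ J := by
  have h : incV δ 1 * incH δ 1 * incF δ s ∈ J.restrictScalars k :=
    hJ.eq.ge (mul_mem_triangularForm_right 1 1 hs)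
  simpa using h

theorem projV_mem (g : Module.Dual k H) {a : FreeDouble δ} (ha : a ∈ J) : projV hδ g a ∈ Im := by
  refine triangularForm_le (S := Im.comap (projV hδ g)) (fun t ht h s => ?_)
    (fun t h s hs => ?_) (hJ.restrictScalars_le ha)
  · simpa using Im.smul_mem _ ht
  · have augmentation_eq_zero : TensorAlgebra.algebraMapInv s = 0 := hJ.plus_le hs
    simp [augmentation_eq_zero]

theorem projF_mem (g : Module.Dual k H) {a : FreeDouble δ} (ha : a ∈ J) : projF hδ g a ∈ Ip := by
  refine triangularForm_le (S := Ip.comap (projF hδ g)) (fun t ht h s => ?_)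
    (fun t h s hs => ?_) (hJ.restrictScalars_le ha)
  · have augmentation_eq_zero : TensorAlgebra.algebraMapInv t = 0 := hJ.minus_le ht
    simp [augmentation_eq_zero]
  · simpa using Ip.smul_mem _ hs

include hδ

theorem comap_incV : (J.comap (incV δ)).restrictScalars k = Im := by
  refine le_antisymm (fun t ht => ?_) fun t ht => hJ.incV_mem ht
  rw [← projV_incV hδ t]
  exact hJ.projV_mem hδ _ ht

theorem comap_incF : (J.comap (incF δ)).restrictScalars k = Ip := by
  refine le_antisymm (fun s hs => ?_) fun s hs => hJ.incF_mem hs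
  rw [← projF_incF hδ s]
  exact hJ.projF_mem hδ _ hs

end HasTriangularForm

theorem sSup_isTwoSided {R : Type*} [Ring R] {S : Set (Ideal R)}
    (hS : ∀ J ∈ S, J.IsTwoSided) : (sSup S).IsTwoSided where
  mul_mem_of_left {a} b ha := by
    rw [sSup_eq_iSup'] at ha
    induction ha using Submodule.iSup_induction' with
    | mem J x hx => exact le_sSup J.2 ((hS J J.2).mul_mem_of_left b hx)
    | zero => simp
    | add x y _ _ hx hy => rw [add_mul]; exact add_mem hx hy

theorem IsTriangularIdeal.le_sumTriangular (hJ : IsTriangularIdeal δ J) : J ≤ sumTriangular δ :=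
  le_sSup hJ

theorem sumTriangular_le {S : Submodule k (FreeDouble δ)}
    (h : ∀ J Im Ip, HasTriangularForm δ J Im Ip → J.restrictScalars k ≤ S) :
    (sumTriangular δ).restrictScalars k ≤ S := by
  rw [sumTriangular, Submodule.restrictScalars_sSup, sSup_le_iff, Set.forall_mem_image]
  rintro J ⟨Im, Ip, hJ⟩
  exact h J Im Ip hJ

instance : (sumTriangular δ).IsTwoSided :=
  sSup_isTwoSided fun _ ⟨_, _, hJ⟩ => hJ.twoSided

theorem isTriangularIdeal_sumTriangular : IsTriangularIdeal δ (sumTriangular δ) :=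
  ⟨(idealV δ).restrictScalars k ⊓ posPart k V,
    (idealF δ).restrictScalars k ⊓ posPart k (Module.Dual k V),
    .mk_of_le inferInstance inf_le_right inf_le_right (fun _ ht => ht.1) (fun _ hs => hs.1) <|
      sumTriangular_le fun J Im Ip hJ =>
        have le_sum : J ≤ sumTriangular δ := IsTriangularIdeal.le_sumTriangular ⟨Im, Ip, hJ⟩
        hJ.restrictScalars_le.trans <| triangularForm_mono
          (fun _ ht => ⟨le_sum (hJ.incV_mem ht), hJ.minus_le ht⟩)
          (fun _ hs => ⟨le_sum (hJ.incF_mem hs), hJ.plus_le hs⟩)⟩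

theorem isGreatest_sumTriangular : IsGreatest {J | IsTriangularIdeal δ J} (sumTriangular δ) :=
  ⟨isTriangularIdeal_sumTriangular, fun _ hJ => hJ.le_sumTriangular⟩

include hδ in
theorem hasTriangularForm_sumTriangular : HasTriangularForm δ (sumTriangular δ)
    ((idealV δ).restrictScalars k) ((idealF δ).restrictScalars k) := by
  obtain ⟨Im, Ip, hJ⟩ := isTriangularIdeal_sumTriangular (δ := δ)
  rw [idealV, idealF, hJ.comap_incV hδ, hJ.comap_incF hδ]
  exact hJ

end TriangularIdeals

section TriangularDecomposition

variable {A : Type x} [Ring A] [Algebra k A] {q : FreeDouble δ →ₐ[k] A}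

theorem toNormal_surjective : Function.Surjective (toNormal hδ) := by
  rw [← LinearMap.range_eq_top, eq_top_iff, ← TensorProduct.span_tmul_eq_top, Submodule.span_le]
  rintro _ ⟨t, n, rfl⟩
  induction n using TensorProduct.induction_on with
  | zero => simp
  | add x y hx hy => rw [TensorProduct.tmul_add]; exact add_mem hx hy
  | tmul h s => exact ⟨_, toNormal_mul_mul hδ t h s⟩

/-- The source of `triangularMap`. -/
abbrev QuotientNormalForm (q : FreeDouble δ →ₐ[k] A) :=
  (TensorAlgebra k V ⧸ LinearMap.ker (q.comp (incV δ)).toLinearMap) ⊗[k] H ⊗[k]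
    (TensorAlgebra k (Module.Dual k V) ⧸ LinearMap.ker (q.comp (incF δ)).toLinearMap)

/-- The normal form of an element of `Ã(V, δ)`, with its two outer legs reduced modulo the kernels
of `T(V) → A` and `T(V*) → A`. -/
def toQuotientNormal (q : FreeDouble δ →ₐ[k] A) : FreeDouble δ →ₗ[k] QuotientNormalForm q :=
  TensorProduct.map (LinearMap.rTensor H (Submodule.mkQ _)) (Submodule.mkQ _) ∘ₗ
    (TensorProduct.assoc k _ H _).symm.toLinearMap ∘ₗ toNormal hδ

@[simp] theorem toQuotientNormal_mul_mul (t : TensorAlgebra k V) (h : H)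
    (s : TensorAlgebra k (Module.Dual k V)) :
    toQuotientNormal hδ q (incV δ t * incH δ h * incF δ s) =
      (Submodule.mkQ _ t ⊗ₜ h) ⊗ₜ Submodule.mkQ _ s := by
  rw [toQuotientNormal, LinearMap.comp_apply, LinearMap.comp_apply, toNormal_mul_mul]
  rfl

theorem toQuotientNormal_surjective : Function.Surjective (toQuotientNormal hδ q) := by
  simp only [toQuotientNormal, LinearMap.coe_comp, LinearEquiv.coe_coe]
  exact (TensorProduct.map_surjective (LinearMap.rTensor_surjective H (Submodule.mkQ_surjective _))
    (Submodule.mkQ_surjective _)).comp <|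
      (LinearEquiv.surjective _).comp (toNormal_surjective hδ)

theorem triangularMap_toQuotientNormal (a : FreeDouble δ) :
    triangularMap δ q (toQuotientNormal hδ q a) = q a := by
  induction a using normal_induction with
  | add x y hx hy => simp only [map_add, hx, hy]
  | mul t h s =>
    rw [toQuotientNormal_mul_mul, map_mul, map_mul]
    rfl

theorem toQuotientNormal_eq_zero (hq : IsTriangularIdeal δ (RingHom.ker q)) {a : FreeDouble δ}
    (ha : q a = 0) : toQuotientNormal hδ q a = 0 := by
  obtain ⟨Im, Ip, hJ⟩ := hq
  refine triangularForm_le (S := LinearMap.ker (toQuotientNormal hδ q)) (fun t ht h s => ?_)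
    (fun t h s hs => ?_) (hJ.restrictScalars_le ha)
  · have mk_eq_zero : Submodule.mkQ (LinearMap.ker (q.comp (incV δ)).toLinearMap) t = 0 :=
      (Submodule.Quotient.mk_eq_zero _).2 (hJ.incV_mem ht)
    rw [LinearMap.mem_ker, toQuotientNormal_mul_mul, mk_eq_zero, TensorProduct.zero_tmul,
      TensorProduct.zero_tmul]
  · have mk_eq_zero : Submodule.mkQ (LinearMap.ker (q.comp (incF δ)).toLinearMap) s = 0 :=
      (Submodule.Quotient.mk_eq_zero _).2 (hJ.incF_mem hs)
    rw [LinearMap.mem_ker, toQuotientNormal_mul_mul, mk_eq_zero, TensorProduct.tmul_zero]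

include hδ in
theorem triangularMap_bijective (hq : IsBraidedDouble δ q) :
    Function.Bijective (triangularMap δ q) := by
  refine ⟨(injective_iff_map_eq_zero _).2 fun z hz => ?_, fun b => ?_⟩
  · obtain ⟨a, rfl⟩ := toQuotientNormal_surjective hδ z
    exact toQuotientNormal_eq_zero hδ hq.2 (by rw [← triangularMap_toQuotientNormal hδ, hz])
  · obtain ⟨a, rfl⟩ := hq.1 b
    exact ⟨_, triangularMap_toQuotientNormal hδ a⟩

end TriangularDecomposition

section MinimalDoubles

theorem map_isTwoSided {R S : Type*} [Ring R] [Ring S] {F : Type*}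
    [FunLike F R S] [RingHomClass F R S] {f : F} (hf : Function.Surjective f) (J : Ideal R)
    [J.IsTwoSided] : (J.map f).IsTwoSided where
  mul_mem_of_left {a} b ha := by
    obtain ⟨x, hx, rfl⟩ := (Ideal.mem_map_iff_of_surjective f hf).1 ha
    obtain ⟨y, rfl⟩ := hf b
    rw [← map_mul]
    exact Ideal.mem_map_of_mem f (J.mul_mem_right y hx)

variable {A : Type x} [Ring A] [Algebra k A] {q : FreeDouble δ →ₐ[k] A}

theorem ker_mkₐ_comp (K : Ideal A) [K.IsTwoSided] :
    RingHom.ker ((Ideal.Quotient.mkₐ k K).comp q) = K.comap q := by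
  ext a
  simp [RingHom.mem_ker, Ideal.Quotient.eq_zero_iff_mem]

theorem comap_map_sumTriangular (hq : IsBraidedDouble δ q) :
    ((sumTriangular δ).map q).comap q = sumTriangular δ := by
  rw [Ideal.comap_map_of_surjective' q hq.1, sup_eq_left]
  exact hq.2.le_sumTriangular

theorem isMinimalDouble_iff :
    IsMinimalDouble δ q ↔ Function.Surjective q ∧ RingHom.ker q = sumTriangular δ := by
  refine ⟨fun ⟨hq, hmin⟩ => ⟨hq.1, ?_⟩, fun ⟨hq, hker⟩ => ⟨⟨hq, ?_⟩, ?_⟩⟩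
  · have twoSided := map_isTwoSided hq.1 (sumTriangular δ)
    have map_eq_bot : (sumTriangular δ).map q = ⊥ := by
      refine hmin _ ⟨twoSided, (Ideal.Quotient.mkₐ_surjective k _).comp hq.1, ?_⟩
      rw [ker_mkₐ_comp, comap_map_sumTriangular hq]
      exact isTriangularIdeal_sumTriangular
    rw [← comap_map_sumTriangular hq, map_eq_bot]
    rfl
  · rw [hker]
    exact isTriangularIdeal_sumTriangular
  · rintro K ⟨_, -, hK⟩
    rw [ker_mkₐ_comp] at hK
    have comap_le : K.comap q ≤ RingHom.ker q := hker ▸ hK.le_sumTriangular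
    rw [← Ideal.map_comap_of_surjective q hq K, Ideal.map_eq_bot_iff_le_ker]
    exact comap_le

theorem existsUnique_minimal_quotient (hq : IsBraidedDouble δ q) :
    ∃! K : Ideal A, ∃ _ : K.IsTwoSided, IsMinimalDouble δ ((Ideal.Quotient.mkₐ k K).comp q) := by
  have twoSided := map_isTwoSided hq.1 (sumTriangular δ)
  refine ⟨(sumTriangular δ).map q, ⟨twoSided, ?_⟩, ?_⟩
  · rw [isMinimalDouble_iff, ker_mkₐ_comp]
    exact ⟨(Ideal.Quotient.mkₐ_surjective k _).comp hq.1, comap_map_sumTriangular hq⟩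
  · rintro K ⟨_, hK⟩
    rw [isMinimalDouble_iff, ker_mkₐ_comp] at hK
    rw [← hK.2, Ideal.map_comap_of_surjective q hq.1]

end MinimalDoubles

end Triangularity

/-! ### Gradings -/

section Gradings

variable {k : Type u} {H : Type v} {V : Type w} [Field k] [Ring H] [Bialgebra k H]
variable [AddCommGroup V] [Module k V] [Module H V] [IsScalarTower k H V]
variable {δ : V →ₗ[k] H ⊗[k] V}

section Coaction

variable {R A G : Type*} [CommRing R] [Ring A] [Algebra R A] [AddGroup G]
variable (Γ : A →ₐ[R] AddMonoidAlgebra A G)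

/-- The degree `n` component of an element of `A`, for a grading of `A` by `G` given as a coaction
`Γ : A → A[G]`. -/
def component (n : G) : A →ₗ[R] A where
  toFun a := (Γ a).coeff n
  map_add' a b := by simp
  map_smul' c a := by simp

variable {Γ} {J : Ideal A} {b : A} {m : G}

theorem component_of_homogeneous [DecidableEq G] (hb : Γ b = .single m b) (n : G) :
    component Γ n b = if m = n then b else 0 := by
  rw [component, LinearMap.coe_mk, AddHom.coe_mk, hb]
  exact Finsupp.single_apply

theorem component_homogeneous_mul (hb : Γ b = .single m b) (n : G) (a : A) :
    component Γ (m + n) (b * a) = b * component Γ n a := by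
  simp [component, hb, AddMonoidAlgebra.coeff_single_mul_apply]

theorem component_mul_homogeneous (hb : Γ b = .single m b) (n : G) (a : A) :
    component Γ (n + m) (a * b) = component Γ n a * b := by
  simp [component, hb, AddMonoidAlgebra.coeff_mul_single_apply]

variable (Γ J) in
/-- The span of the homogeneous components of the elements of `J`. -/
def componentSpan : Submodule R A :=
  Submodule.span R {x | ∃ n, ∃ a ∈ J, component Γ n a = x}

theorem component_mem_componentSpan {a : A} (ha : a ∈ J) (n : G) :
    component Γ n a ∈ componentSpan Γ J :=
  Submodule.subset_span ⟨n, a, ha, rfl⟩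

theorem componentSpan_le {S : Submodule R A} (h : ∀ n, ∀ a ∈ J, component Γ n a ∈ S) :
    componentSpan Γ J ≤ S := by
  refine Submodule.span_le.2 ?_
  rintro _ ⟨n, a, ha, rfl⟩
  exact h n a ha

variable (hΓ : Algebra.adjoin R {b | ∃ m, Γ b = .single m b} = ⊤)
include hΓ

theorem mul_mem_componentSpan (b : A) {x : A} (hx : x ∈ componentSpan Γ J) :
    b * x ∈ componentSpan Γ J := by
  have hb : b ∈ Algebra.adjoin R {b | ∃ m, Γ b = .single m b} := hΓ ▸ Algebra.mem_top
  induction hb using Algebra.adjoin_induction generalizing x with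
  | mem b hb =>
    obtain ⟨m, hb⟩ := hb
    refine componentSpan_le (S := (componentSpan Γ J).comap (LinearMap.mulLeft R b))
      (fun n a ha => ?_) hx
    rw [Submodule.mem_comap, LinearMap.mulLeft_apply, ← component_homogeneous_mul hb]
    exact component_mem_componentSpan (J.mul_mem_left b ha) _
  | algebraMap c =>
    rw [← Algebra.smul_def]
    exact Submodule.smul_mem _ c hx
  | add b c _ _ hb hc => rw [add_mul]; exact add_mem (hb hx) (hc hx)
  | mul b c _ _ hb hc => rw [mul_assoc]; exact hb (hc hx)

theorem componentSpan_mul_mem [J.IsTwoSided] (b : A) {x : A} (hx : x ∈ componentSpan Γ J) :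
    x * b ∈ componentSpan Γ J := by
  have hb : b ∈ Algebra.adjoin R {b | ∃ m, Γ b = .single m b} := hΓ ▸ Algebra.mem_top
  induction hb using Algebra.adjoin_induction generalizing x with
  | mem b hb =>
    obtain ⟨m, hb⟩ := hb
    refine componentSpan_le (S := (componentSpan Γ J).comap (LinearMap.mulRight R b))
      (fun n a ha => ?_) hx
    rw [Submodule.mem_comap, LinearMap.mulRight_apply, ← component_mul_homogeneous hb]
    exact component_mem_componentSpan (J.mul_mem_right b ha) _
  | algebraMap c =>
    rw [← Algebra.commutes, ← Algebra.smul_def]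
    exact Submodule.smul_mem _ c hx
  | add b c _ _ hb hc => rw [mul_add]; exact add_mem (hb hx) (hc hx)
  | mul b c _ _ hb hc => rw [← mul_assoc]; exact hc (hb hx)

variable (J) in
/-- The homogeneous hull of an ideal: the ideal generated by the homogeneous components of its
elements. -/
def homogeneousHull : Ideal A where
  toAddSubmonoid := (componentSpan Γ J).toAddSubmonoid
  smul_mem' b _ hx := mul_mem_componentSpan hΓ b hx

theorem component_mem_homogeneousHull {a : A} (ha : a ∈ J) (n : G) :
    component Γ n a ∈ homogeneousHull J hΓ :=
  component_mem_componentSpan ha n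

theorem homogeneousHull_isTwoSided [J.IsTwoSided] : (homogeneousHull J hΓ).IsTwoSided where
  mul_mem_of_left b hx := componentSpan_mul_mem hΓ b hx

end Coaction

section TensorParts

variable {M : Type x} [AddCommGroup M] [Module k M]

variable (k M) in
/-- The grading `n ↦ M^{⊗n}` of the tensor algebra `T(M)`. -/
abbrev tensorGrading : ℕ → Submodule k (TensorAlgebra k M) :=
  fun n => LinearMap.range (TensorAlgebra.ι k : M →ₗ[k] TensorAlgebra k M) ^ n

/-- The component of degree `n` of an element of the tensor algebra. -/
abbrev tensorPart (n : ℕ) : TensorAlgebra k M →ₗ[k] TensorAlgebra k M :=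
  GradedAlgebra.proj (tensorGrading k M) n

theorem tensorPart_mem (n : ℕ) (t : TensorAlgebra k M) : tensorPart n t ∈ tensorGrading k M n :=
  SetLike.coe_mem _

theorem exists_sum_tensorPart (t : TensorAlgebra k M) :
    ∃ S : Finset ℕ, t = ∑ n ∈ S, tensorPart n t := by
  classical exact ⟨_, (DirectSum.sum_support_decompose (tensorGrading k M) t).symm⟩

theorem tensorPart_of_mem {n : ℕ} {t : TensorAlgebra k M} (ht : t ∈ tensorGrading k M n) (m : ℕ) :
    tensorPart m t = if n = m then t else 0 := by
  split_ifs with h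
  · subst h
    exact DirectSum.decompose_of_mem_same _ ht
  · exact DirectSum.decompose_of_mem_ne _ ht h

theorem linearMap_eq_of_tensorGrading {N : Type*} [AddCommMonoid N] [Module k N]
    {f g : TensorAlgebra k M →ₗ[k] N} (h : ∀ n, ∀ t ∈ tensorGrading k M n, f t = g t) : f = g := by
  ext t
  induction t using DirectSum.Decomposition.inductionOn (tensorGrading k M) with
  | zero => simp
  | homogeneous t => exact h _ _ t.2
  | add s t hs ht => rw [map_add, map_add, hs, ht]

theorem mem_posPart_of_mem {n : ℕ} (hn : n ≠ 0) {t : TensorAlgebra k M}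
    (ht : t ∈ tensorGrading k M n) : t ∈ posPart k M := by
  obtain ⟨n, rfl⟩ := Nat.exists_eq_succ_of_ne_zero hn
  refine Submodule.mul_le.2 ?_ ((pow_succ' (LinearMap.range (TensorAlgebra.ι k)) n).le ht)
  rintro _ ⟨m, rfl⟩ s -
  simp [posPart, TensorAlgebra.algebraMapInv]

theorem algebraMapInv_tensorPart (n : ℕ) (t : TensorAlgebra k M) :
    TensorAlgebra.algebraMapInv (tensorPart n t) =
      if n = 0 then TensorAlgebra.algebraMapInv t else 0 := by
  split_ifs with hn
  · subst hn
    refine LinearMap.congr_fun (f := TensorAlgebra.algebraMapInv.toLinearMap ∘ₗ tensorPart 0)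
      (g := TensorAlgebra.algebraMapInv.toLinearMap)
      (linearMap_eq_of_tensorGrading fun m t ht => ?_) t
    rw [LinearMap.comp_apply, tensorPart_of_mem ht]
    split_ifs with hm
    · rfl
    · rw [map_zero]
      exact (mem_posPart_of_mem hm ht).symm
  · exact mem_posPart_of_mem hn (tensorPart_mem n t)

theorem tensorPart_mem_posPart {t : TensorAlgebra k M} (ht : t ∈ posPart k M) (n : ℕ) :
    tensorPart n t ∈ posPart k M := by
  have augmentation_eq_zero : TensorAlgebra.algebraMapInv t = 0 := ht
  exact (algebraMapInv_tensorPart n t).trans (by rw [augmentation_eq_zero, ite_self])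

theorem algHom_eq_single {A : Type*} [Ring A] [Algebra k A] (f : TensorAlgebra k M →ₐ[k] A)
    (Γ : A →ₐ[k] AddMonoidAlgebra A ℤ) {d : ℤ}
    (h : ∀ m, Γ (f (TensorAlgebra.ι k m)) = .single d (f (TensorAlgebra.ι k m))) {n : ℕ}
    {t : TensorAlgebra k M} (ht : t ∈ tensorGrading k M n) :
    Γ (f t) = .single (n * d) (f t) := by
  induction ht using Submodule.pow_induction_on_left' with
  | algebraMap c => simp
  | add x y i _ _ ihx ihy => rw [map_add, map_add, ihx, ihy, AddMonoidAlgebra.single_add]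
  | mem_mul m hm i x _ ih =>
    obtain ⟨m, rfl⟩ := hm
    rw [map_mul, map_mul, ih, h, AddMonoidAlgebra.single_mul_single]
    congr 1
    push_cast
    ring

end TensorParts

section Grading

variable (δ)

/-- The realization of `Ã(V, δ)` in `Ã(V, δ)[ℤ]` with `V` in degree `1`, `H` in degree `0` and `V*`
in degree `-1`. -/
def gradedRealization : Realization δ (AddMonoidAlgebra (FreeDouble δ) ℤ) where
  toV := AddMonoidAlgebra.lsingle 1 ∘ₗ (incV δ).toLinearMap ∘ₗ TensorAlgebra.ι k
  toH := AlgHom.ofLinearMap (AddMonoidAlgebra.lsingle 0 ∘ₗ incH δ)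
    (by rw [LinearMap.comp_apply, incH_one, AddMonoidAlgebra.lsingle_apply]; rfl)
    (fun a b => by
      simp only [LinearMap.comp_apply, incH_mul, AddMonoidAlgebra.lsingle_apply,
        AddMonoidAlgebra.single_mul_single, add_zero])
  toF := AddMonoidAlgebra.lsingle (-1) ∘ₗ (incF δ).toLinearMap ∘ₗ TensorAlgebra.ι k
  toH_mul_toV h v := by
    simp only [AlgHom.ofLinearMap_apply, LinearMap.comp_apply, AlgHom.toLinearMap_apply,
      AddMonoidAlgebra.lsingle_apply, AddMonoidAlgebra.single_mul_single,
      incH_mul_incV_ι δ (ℛ k h), zero_add, add_zero]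
    exact map_sum (AddMonoidAlgebra.lsingle (R := k) 1) _ _
  toF_mul_toH f h := by
    simp only [AlgHom.ofLinearMap_apply, LinearMap.comp_apply, AlgHom.toLinearMap_apply,
      AddMonoidAlgebra.lsingle_apply, AddMonoidAlgebra.single_mul_single,
      incF_ι_mul_incH δ (ℛ k h), zero_add, add_zero]
    exact map_sum (AddMonoidAlgebra.lsingle (R := k) (-1)) _ _
  toF_mul_toV f v := by
    simp only [AlgHom.ofLinearMap_apply, LinearMap.comp_apply, AlgHom.toLinearMap_apply,
      AddMonoidAlgebra.lsingle_apply, AddMonoidAlgebra.single_mul_single,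
      incF_ι_mul_incV_ι, AddMonoidAlgebra.single_add, neg_add_cancel, add_neg_cancel]

/-- The `ℤ`-grading of `Ã(V, δ)` with `V` in degree `1`, `H` in degree `0` and `V*` in degree `-1`,
as a coaction. -/
def grading : FreeDouble δ →ₐ[k] AddMonoidAlgebra (FreeDouble δ) ℤ :=
  (gradedRealization δ).lift

theorem grading_incH (h : H) : grading δ (incH δ h) = .single 0 (incH δ h) :=
  (gradedRealization δ).lift_incH h

variable {δ} in
theorem grading_incV {n : ℕ} {t : TensorAlgebra k V} (ht : t ∈ tensorGrading k V n) :
    grading δ (incV δ t) = .single (n : ℤ) (incV δ t) := by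
  simpa only [mul_one] using
    algHom_eq_single (incV δ) (grading δ) (gradedRealization δ).lift_incV_ι ht

variable {δ} in
theorem grading_incF {n : ℕ} {s : TensorAlgebra k (Module.Dual k V)}
    (hs : s ∈ tensorGrading k (Module.Dual k V) n) :
    grading δ (incF δ s) = .single (-n : ℤ) (incF δ s) := by
  simpa only [mul_neg_one] using
    algHom_eq_single (incF δ) (grading δ) (gradedRealization δ).lift_incF_ι hs

theorem ι_mem_tensorGrading_one {M : Type x} [AddCommGroup M] [Module k M] (m : M) :
    TensorAlgebra.ι k m ∈ tensorGrading k M 1 :=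
  (pow_one (LinearMap.range (TensorAlgebra.ι k))).ge ⟨m, rfl⟩

theorem adjoin_homogeneous_eq_top :
    Algebra.adjoin k {b | ∃ m, grading δ b = .single m b} = ⊤ := by
  refine eq_top_iff.2 fun a _ => ?_
  induction a using freeDouble_induction with
  | add a b ha hb => exact add_mem (ha trivial) (hb trivial)
  | scalar c => exact Subalgebra.algebraMap_mem _ c
  | mul a b ha hb => exact mul_mem (ha trivial) (hb trivial)
  | incV_ι v => exact Algebra.subset_adjoin ⟨_, grading_incV (ι_mem_tensorGrading_one v)⟩
  | incH h => exact Algebra.subset_adjoin ⟨_, grading_incH δ h⟩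
  | incF_ι f => exact Algebra.subset_adjoin ⟨_, grading_incF (ι_mem_tensorGrading_one f)⟩

theorem component_incV (n : ℕ) (t : TensorAlgebra k V) :
    component (grading δ) n (incV δ t) = incV δ (tensorPart n t) := by
  refine LinearMap.congr_fun (f := component (grading δ) (n : ℤ) ∘ₗ (incV δ).toLinearMap)
    (g := (incV δ).toLinearMap ∘ₗ tensorPart n) (linearMap_eq_of_tensorGrading fun m t ht => ?_) t
  simp [component_of_homogeneous (grading_incV ht), tensorPart_of_mem ht, apply_ite (incV δ)]

theorem component_incF (n : ℕ) (s : TensorAlgebra k (Module.Dual k V)) :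
    component (grading δ) (-n) (incF δ s) = incF δ (tensorPart n s) := by
  refine LinearMap.congr_fun (f := component (grading δ) (-n : ℤ) ∘ₗ (incF δ).toLinearMap)
    (g := (incF δ).toLinearMap ∘ₗ tensorPart n) (linearMap_eq_of_tensorGrading fun m s hs => ?_) s
  simp [component_of_homogeneous (grading_incF hs), tensorPart_of_mem hs, apply_ite (incF δ)]

variable {δ}

theorem component_mul_mul_mem (n : ℤ) {S : Submodule k (FreeDouble δ)} (t : TensorAlgebra k V)
    (h : H) (s : TensorAlgebra k (Module.Dual k V))
    (hS : ∀ i j, incV δ (tensorPart i t) * incH δ h * incF δ (tensorPart j s) ∈ S) :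
    component (grading δ) n (incV δ t * incH δ h * incF δ s) ∈ S := by
  obtain ⟨A, hA⟩ := exists_sum_tensorPart t
  obtain ⟨B, hB⟩ := exists_sum_tensorPart s
  have mul_mul_eq_sum : incV δ t * incH δ h * incF δ s = ∑ i ∈ A, ∑ j ∈ B,
      incV δ (tensorPart i t) * incH δ h * incF δ (tensorPart j s) := by
    conv_lhs => rw [hA, hB]
    simp only [map_sum, Finset.sum_mul, Finset.mul_sum]
    exact Finset.sum_comm
  rw [mul_mul_eq_sum, map_sum]
  refine sum_mem fun i _ => ?_
  rw [map_sum]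
  refine sum_mem fun j _ => ?_
  have homogeneous : grading δ (incV δ (tensorPart i t) * incH δ h * incF δ (tensorPart j s)) =
      .single (i + 0 + -j) (incV δ (tensorPart i t) * incH δ h * incF δ (tensorPart j s)) := by
    rw [map_mul, map_mul, grading_incV (tensorPart_mem i t), grading_incH,
      grading_incF (tensorPart_mem j s), AddMonoidAlgebra.single_mul_single,
      AddMonoidAlgebra.single_mul_single]
  rw [component_of_homogeneous homogeneous]
  split_ifs
  exacts [hS i j, zero_mem _]

theorem component_mem_triangularForm {Im Im' : Submodule k (TensorAlgebra k V)}
    {Ip Ip' : Submodule k (TensorAlgebra k (Module.Dual k V))}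
    (hm : ∀ t ∈ Im, ∀ i, tensorPart i t ∈ Im') (hp : ∀ s ∈ Ip, ∀ j, tensorPart j s ∈ Ip') (n : ℤ)
    {a : FreeDouble δ} (ha : a ∈ triangularForm δ Im Ip) :
    component (grading δ) n a ∈ triangularForm δ Im' Ip' :=
  triangularForm_le (S := (triangularForm δ Im' Ip').comap (component (grading δ) n))
    (fun t ht h s => component_mul_mul_mem n t h s fun i _ =>
      mul_mem_triangularForm_left (hm t ht i) h _)
    (fun t h s hs => component_mul_mul_mem n t h s fun _ j =>
      mul_mem_triangularForm_right _ h (hp s hs j)) ha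

theorem HasTriangularForm.isTriangularIdeal_of_componentSpan {J K : Ideal (FreeDouble δ)}
    {Im : Submodule k (TensorAlgebra k V)} {Ip : Submodule k (TensorAlgebra k (Module.Dual k V))}
    (hJ : HasTriangularForm δ J Im Ip) (hK : K.IsTwoSided)
    (hJK : K.restrictScalars k = componentSpan (grading δ) J) : IsTriangularIdeal δ K := by
  have component_mem : ∀ a ∈ J, ∀ n, component (grading δ) n a ∈ K := fun a ha n =>
    hJK.ge (component_mem_componentSpan ha n)
  have tensorPart_mem_left : ∀ t ∈ Im, ∀ i,
      tensorPart i t ∈ (K.comap (incV δ)).restrictScalars k ⊓ posPart k V := fun t ht i => by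
    have incV_mem := component_mem _ (hJ.incV_mem ht) i
    rw [component_incV] at incV_mem
    exact ⟨incV_mem, tensorPart_mem_posPart (hJ.minus_le ht) i⟩
  have tensorPart_mem_right : ∀ s ∈ Ip, ∀ j, tensorPart j s ∈
      (K.comap (incF δ)).restrictScalars k ⊓ posPart k (Module.Dual k V) := fun s hs j => by
    have incF_mem := component_mem _ (hJ.incF_mem hs) (-j)
    rw [component_incF] at incF_mem
    exact ⟨incF_mem, tensorPart_mem_posPart (hJ.plus_le hs) j⟩
  exact ⟨_, _, .mk_of_le hK inf_le_right inf_le_right (fun t ht => ht.1) (fun s hs => hs.1)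
    (hJK.trans_le (componentSpan_le fun n a ha => component_mem_triangularForm
      tensorPart_mem_left tensorPart_mem_right n (hJ.restrictScalars_le ha)))⟩

theorem HasTriangularForm.homogeneousHull {J : Ideal (FreeDouble δ)}
    {Im : Submodule k (TensorAlgebra k V)} {Ip : Submodule k (TensorAlgebra k (Module.Dual k V))}
    (hJ : HasTriangularForm δ J Im Ip) :
    IsTriangularIdeal δ (homogeneousHull J (adjoin_homogeneous_eq_top δ)) :=
  have := hJ.twoSided
  hJ.isTriangularIdeal_of_componentSpan (homogeneousHull_isTwoSided _) rfl

theorem component_mem_sumTriangular {a : FreeDouble δ} (ha : a ∈ sumTriangular δ) (n : ℤ) :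
    component (grading δ) n a ∈ sumTriangular δ :=
  sumTriangular_le (S := ((sumTriangular δ).restrictScalars k).comap (component (grading δ) n))
    (fun _ _ _ hJ _ ha => hJ.homogeneousHull.le_sumTriangular
      (component_mem_homogeneousHull _ ha n)) ha

variable (δ)

theorem idealV_isHomogeneous : (idealV δ).IsHomogeneous (tensorGrading k V) := fun n t ht => by
  have incV_tensorPart_mem : incV δ (tensorPart n t) ∈ sumTriangular δ := by
    rw [← component_incV]
    exact component_mem_sumTriangular ht n
  exact incV_tensorPart_mem

theorem idealF_isHomogeneous : (idealF δ).IsHomogeneous (tensorGrading k (Module.Dual k V)) :=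
  fun n s hs => by
    have incF_tensorPart_mem : incF δ (tensorPart n s) ∈ sumTriangular δ := by
      rw [← component_incF]
      exact component_mem_sumTriangular hs _
    exact incF_tensorPart_mem

end Grading

end Gradings

/-! ### Tensor powers -/

section TensorPowers

variable {k : Type u} {M : Type x} [Field k] [AddCommGroup M] [Module k M]

theorem consEquiv_induction {n : ℕ} {p : (⨂[k]^(n + 1) M) → Prop}
    (add : ∀ x y, p x → p y → p (x + y)) (cons : ∀ m t, p (consEquiv k M n (m ⊗ₜ t)))
    (u : ⨂[k]^(n + 1) M) : p u := by
  obtain ⟨z, rfl⟩ := (consEquiv k M n).surjective u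
  induction z using TensorProduct.induction_on with
  | zero => simpa using cons 0 0
  | add x y hx hy => rw [map_add]; exact add _ _ hx hy
  | tmul m t => exact cons m t

theorem snocEquiv_induction {n : ℕ} {p : (⨂[k]^(n + 1) M) → Prop}
    (add : ∀ x y, p x → p y → p (x + y)) (snoc : ∀ t m, p (snocEquiv k M n (t ⊗ₜ m)))
    (u : ⨂[k]^(n + 1) M) : p u := by
  obtain ⟨z, rfl⟩ := (snocEquiv k M n).surjective u
  induction z using TensorProduct.induction_on with
  | zero => simpa using snoc 0 0
  | add x y hx hy => rw [map_add]; exact add _ _ hx hy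
  | tmul t m => exact snoc t m

theorem toTensorAlgebra_zero (u : ⨂[k]^0 M) :
    TensorPower.toTensorAlgebra u = algebraMap k (TensorAlgebra k M)
      (PiTensorProduct.isEmptyEquiv (Fin 0) u) := by
  induction u using PiTensorProduct.induction_on with
  | smul_tprod c a =>
    simp [TensorAlgebra.tprod_apply, Algebra.algebraMap_eq_smul_one]
  | add x y hx hy => simp only [map_add, hx, hy]

theorem toTensorAlgebra_consEquiv (n : ℕ) (m : M) (t : ⨂[k]^n M) :
    TensorPower.toTensorAlgebra (consEquiv k M n (m ⊗ₜ t)) =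
      TensorAlgebra.ι k m * TensorPower.toTensorAlgebra t := by
  induction t using PiTensorProduct.induction_on with
  | smul_tprod c a =>
    simp [consEquiv_tprod, TensorAlgebra.tprod_apply, List.ofFn_succ]
  | add x y hx hy => rw [TensorProduct.tmul_add, map_add, map_add, map_add, hx, hy, mul_add]

theorem toTensorAlgebra_snocEquiv (n : ℕ) (m : M) (t : ⨂[k]^n M) :
    TensorPower.toTensorAlgebra (snocEquiv k M n (t ⊗ₜ m)) =
      TensorPower.toTensorAlgebra t * TensorAlgebra.ι k m := by
  induction t using PiTensorProduct.induction_on with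
  | smul_tprod c a =>
    rw [← TensorProduct.smul_tmul', map_smul, map_smul, map_smul, snocEquiv_tprod, smul_mul_assoc,
      TensorPower.toTensorAlgebra_tprod, TensorPower.toTensorAlgebra_tprod,
      TensorAlgebra.tprod_apply, TensorAlgebra.tprod_apply, List.ofFn_succ', List.concat_eq_append,
      List.prod_append]
    simp
  | add x y hx hy => rw [TensorProduct.add_tmul, map_add, map_add, map_add, hx, hy, add_mul]

theorem range_toTensorAlgebra (n : ℕ) :
    LinearMap.range (TensorPower.toTensorAlgebra : (⨂[k]^n M) →ₗ[k] TensorAlgebra k M) =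
      tensorGrading k M n := by
  induction n with
  | zero =>
    rw [tensorGrading, pow_zero, Submodule.one_eq_range]
    refine le_antisymm ?_ ?_
    · rintro _ ⟨u, rfl⟩
      exact ⟨_, (toTensorAlgebra_zero u).symm⟩
    · rintro _ ⟨c, rfl⟩
      exact ⟨(PiTensorProduct.isEmptyEquiv (Fin 0)).symm c,
        (toTensorAlgebra_zero _).trans (by rw [LinearEquiv.apply_symm_apply]; rfl)⟩
  | succ n ih =>
    rw [tensorGrading, pow_succ', ← tensorGrading, ← ih]
    refine le_antisymm ?_ (Submodule.mul_le.2 ?_)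
    · rintro _ ⟨u, rfl⟩
      induction u using consEquiv_induction with
      | add x y hx hy => rw [map_add]; exact add_mem hx hy
      | cons m t =>
        rw [toTensorAlgebra_consEquiv]
        exact Submodule.mul_mem_mul ⟨m, rfl⟩ ⟨t, rfl⟩
    · rintro _ ⟨m, rfl⟩ _ ⟨t, rfl⟩
      exact ⟨_, toTensorAlgebra_consEquiv n m t⟩

theorem eq_zero_of_toTensorAlgebra_mem_posPart {u : ⨂[k]^0 M}
    (hu : TensorPower.toTensorAlgebra u ∈ posPart k M) : u = 0 := by
  have augmentation_eq_zero : TensorAlgebra.algebraMapInv (TensorPower.toTensorAlgebra u) = 0 := hu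
  rw [toTensorAlgebra_zero, TensorAlgebra.algebraMap_leftInverse] at augmentation_eq_zero
  exact (LinearEquiv.map_eq_zero_iff _).1 augmentation_eq_zero

/-- The graded subspace `⨁_{n ≥ 1} Cₙ` of `T^{>0}(M)` with homogeneous parts `Cₙ ⊆ M^{⊗n}`. -/
abbrev gradedSpan (C : ∀ n, Submodule k (⨂[k]^n M)) : Submodule k (TensorAlgebra k M) :=
  ⨆ n : ℕ, ⨆ _ : 1 ≤ n, (C n).map TensorPower.toTensorAlgebra

variable {C : ∀ n, Submodule k (⨂[k]^n M)}

theorem gradedSpan_le {S : Submodule k (TensorAlgebra k M)}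
    (hS : ∀ n, ∀ u ∈ C (n + 1), TensorPower.toTensorAlgebra u ∈ S) : gradedSpan C ≤ S :=
  iSup₂_le fun n hn => by
    obtain ⟨n, rfl⟩ := Nat.exists_eq_add_of_le' hn
    exact Submodule.map_le_iff_le_comap.2 (hS n)

theorem toTensorAlgebra_mem_gradedSpan {n : ℕ} {u : ⨂[k]^(n + 1) M} (hu : u ∈ C (n + 1)) :
    TensorPower.toTensorAlgebra u ∈ gradedSpan C :=
  Submodule.mem_iSup_of_mem (n + 1) (Submodule.mem_iSup_of_mem (Nat.le_add_left 1 n)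
    (Submodule.mem_map_of_mem hu))

theorem map_toTensorAlgebra_le_gradedSpan (h_zero : C 0 = ⊥) (n : ℕ) :
    (C n).map TensorPower.toTensorAlgebra ≤ gradedSpan C := by
  cases n with
  | zero => rw [h_zero, Submodule.map_bot]; exact bot_le
  | succ n => exact Submodule.map_le_iff_le_comap.2 fun _ hu => toTensorAlgebra_mem_gradedSpan hu

theorem le_gradedSpan {I : Ideal (TensorAlgebra k M)}
    (hI : I.IsHomogeneous (tensorGrading k M)) (hpos : I.restrictScalars k ≤ posPart k M)
    (hC : ∀ n u, TensorPower.toTensorAlgebra u ∈ I → u ∈ C n) :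
    I.restrictScalars k ≤ gradedSpan C := by
  intro t ht
  obtain ⟨S, hS⟩ := exists_sum_tensorPart t
  rw [hS]
  refine sum_mem fun n _ => ?_
  obtain ⟨u, hu⟩ := (range_toTensorAlgebra n).ge (tensorPart_mem n t)
  have toTensorAlgebra_mem : TensorPower.toTensorAlgebra u ∈ I := hu ▸ hI n ht
  rw [← hu]
  cases n with
  | zero =>
    rw [eq_zero_of_toTensorAlgebra_mem_posPart (hpos toTensorAlgebra_mem), map_zero]
    exact zero_mem _
  | succ n => exact toTensorAlgebra_mem_gradedSpan (hC _ u toTensorAlgebra_mem)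

end TensorPowers

section Slices

section CommSemiring

variable {k A B X Y : Type*} [CommSemiring k] [AddCommMonoid A] [Module k A]
variable [AddCommMonoid B] [Module k B] [AddCommMonoid X] [Module k X]
variable [AddCommMonoid Y] [Module k Y]

variable (X) in
/-- The slice map `x ⊗ a ↦ ψ(a) x`. -/
def sliceRight (ψ : Module.Dual k A) : X ⊗[k] A →ₗ[k] X :=
  (TensorProduct.rid k X).toLinearMap ∘ₗ LinearMap.lTensor X ψ

variable (X) in
/-- The slice map `a ⊗ x ↦ ψ(a) x`. -/
def sliceLeft (ψ : Module.Dual k A) : A ⊗[k] X →ₗ[k] X :=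
  (TensorProduct.lid k X).toLinearMap ∘ₗ LinearMap.rTensor X ψ

@[simp] theorem sliceRight_tmul (ψ : Module.Dual k A) (x : X) (a : A) :
    sliceRight X ψ (x ⊗ₜ a) = ψ a • x := by
  simp [sliceRight]

@[simp] theorem sliceLeft_tmul (ψ : Module.Dual k A) (a : A) (x : X) :
    sliceLeft X ψ (a ⊗ₜ x) = ψ a • x := by
  simp [sliceLeft]

theorem sliceRight_rTensor (ψ : Module.Dual k A) (φ : X →ₗ[k] Y) (z : X ⊗[k] A) :
    sliceRight Y ψ (φ.rTensor A z) = φ (sliceRight X ψ z) :=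
  LinearMap.congr_fun (f := sliceRight Y ψ ∘ₗ φ.rTensor A) (g := φ ∘ₗ sliceRight X ψ)
    (TensorProduct.ext' fun x a => by simp) z

theorem sliceLeft_lTensor (ψ : Module.Dual k A) (φ : X →ₗ[k] Y) (z : A ⊗[k] X) :
    sliceLeft Y ψ (φ.lTensor A z) = φ (sliceLeft X ψ z) :=
  LinearMap.congr_fun (f := sliceLeft Y ψ ∘ₗ φ.lTensor A) (g := φ ∘ₗ sliceLeft X ψ)
    (TensorProduct.ext' fun a x => by simp) z

theorem coord_tensorProduct {ι κ : Type*} (a : Module.Basis ι k A) (b : Module.Basis κ k B)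
    (i : ι × κ) : (a.tensorProduct b).coord i =
      TensorProduct.dualDistrib k A B (a.coord i.1 ⊗ₜ b.coord i.2) :=
  TensorProduct.ext' fun x y => by
    rw [Module.Basis.coord_apply, Module.Basis.tensorProduct_repr_tmul_apply, smul_eq_mul, mul_comm,
      TensorProduct.dualDistrib_apply, Module.Basis.coord_apply, Module.Basis.coord_apply]

end CommSemiring

variable {k A B X : Type*} [Field k] [AddCommGroup A] [Module k A] [AddCommGroup B] [Module k B]
variable [AddCommMonoid X] [Module k X]

theorem eq_zero_of_sliceRight {z : X ⊗[k] (A ⊗[k] B)} (hz : ∀ g f,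
    sliceRight X (TensorProduct.dualDistrib k A B (g ⊗ₜ f)) z = 0) : z = 0 := by
  classical
  let basis := (Module.Basis.ofVectorSpace k A).tensorProduct (Module.Basis.ofVectorSpace k B)
  refine (TensorProduct.equivFinsuppOfBasisRight basis).map_eq_zero_iff.1 (Finsupp.ext fun i => ?_)
  rw [TensorProduct.equivFinsuppOfBasisRight_apply, coord_tensorProduct]
  exact hz _ _

theorem eq_zero_of_sliceLeft {z : (A ⊗[k] B) ⊗[k] X} (hz : ∀ g f,
    sliceLeft X (TensorProduct.dualDistrib k A B (g ⊗ₜ f)) z = 0) : z = 0 := by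
  classical
  let basis := (Module.Basis.ofVectorSpace k A).tensorProduct (Module.Basis.ofVectorSpace k B)
  refine (TensorProduct.equivFinsuppOfBasisLeft basis).map_eq_zero_iff.1 (Finsupp.ext fun i => ?_)
  rw [TensorProduct.equivFinsuppOfBasisLeft_apply, coord_tensorProduct]
  exact hz _ _

end Slices

section TensorPowerAction

variable {k : Type u} {H : Type v} [Field k] [Ring H] [Bialgebra k H]
variable {M : Type w} [AddCommGroup M] [Module k M] (act : H →ₗ[k] M →ₗ[k] M)

theorem powAct_zero_apply (h : H) (t : ⨂[k]^0 M) :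
    powAct act 0 h t = Coalgebra.counit (R := k) h • t := rfl

theorem powAct_consEquiv (n : ℕ) {ι : Type*} {h : H} (r : Coalgebra.Repr k h ι) (m : M)
    (t : ⨂[k]^n M) :
    powAct act (n + 1) h (consEquiv k M n (m ⊗ₜ t)) =
      ∑ i ∈ r.index, consEquiv k M n (act (r.left i) m ⊗ₜ powAct act n (r.right i) t) := by
  simp [powAct, ← r.eq, LinearEquiv.conj_apply]

end TensorPowerAction

section CommutationRules

variable {k : Type u} {H : Type v} {V : Type w}
variable [Field k] [Ring H] [Bialgebra k H]

theorem sum_smul_counit {ι : Type*} {h : H} (r : Coalgebra.Repr k h ι) :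
    ∑ i ∈ r.index, Coalgebra.counit (R := k) (r.right i) • r.left i = h := by
  have h_rid := congrArg (TensorProduct.rid k H) (Coalgebra.sum_tmul_counit_eq r)
  rw [map_sum] at h_rid
  simpa using h_rid

theorem sum_counit_smul_map {X : Type*} [AddCommMonoid X] [Module k X] (φ : H →ₗ[k] X)
    {ι : Type*} {h : H} (r : Coalgebra.Repr k h ι) :
    ∑ i ∈ r.index, Coalgebra.counit (R := k) (r.left i) • φ (r.right i) = φ h := by
  simp only [← map_smul, ← map_sum, Coalgebra.sum_counit_smul r]

theorem sum_smul_counit_map {X : Type*} [AddCommMonoid X] [Module k X] (φ : H →ₗ[k] X)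
    {ι : Type*} {h : H} (r : Coalgebra.Repr k h ι) :
    ∑ i ∈ r.index, Coalgebra.counit (R := k) (r.right i) • φ (r.left i) = φ h := by
  simp only [← map_smul, ← map_sum, sum_smul_counit r]

theorem sum_sum_mul_coassoc {A : Type*} [Semiring A] [Algebra k A] (p q s : H →ₗ[k] A)
    {ι : Type*} {κ κ' : ι → Type*} {h : H} (r : Coalgebra.Repr k h ι)
    (a : ∀ i, Coalgebra.Repr k (r.left i) (κ i)) (b : ∀ i, Coalgebra.Repr k (r.right i) (κ' i)) :
    ∑ i ∈ r.index, ∑ j ∈ (a i).index, p ((a i).left j) * q ((a i).right j) * s (r.right i) =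
      ∑ i ∈ r.index, ∑ j ∈ (b i).index, p (r.left i) * q ((b i).left j) * s ((b i).right j) :=
  sum_sum_coassoc (((LinearMap.mul k A).compl₁₂ p q).compr₂ ((LinearMap.mul k A).compl₂ s)) r a b

variable [AddCommGroup V] [Module k V] [Module H V] [IsScalarTower k H V]
variable (δ : V →ₗ[k] H ⊗[k] V)

theorem incH_mul_incV (n : ℕ) {ι : Type v} {h : H} (r : Coalgebra.Repr k h ι) (u : ⨂[k]^n V) :
    incH δ h * incV δ (TensorPower.toTensorAlgebra u) =
      ∑ i ∈ r.index, incV δ (TensorPower.toTensorAlgebra (powAct (lact k H V) n (r.left i) u)) *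
        incH δ (r.right i) := by
  induction n generalizing ι h with
  | zero =>
    simp only [powAct_zero_apply, map_smul, smul_mul_assoc, ← mul_smul_comm, ← Finset.mul_sum,
      sum_counit_smul_map]
    rw [toTensorAlgebra_zero, AlgHom.commutes, Algebra.commutes]
  | succ n ih =>
    induction u using consEquiv_induction with
    | add x y hx hy => simp only [map_add, mul_add, add_mul, hx, hy, Finset.sum_add_distrib]
    | cons v t =>
      have coassoc := sum_sum_mul_coassoc ((incV δ).toLinearMap ∘ₗ TensorAlgebra.ι k ∘ₗ
          (lact k H V).flip v) ((incV δ).toLinearMap ∘ₗ TensorPower.toTensorAlgebra ∘ₗ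
          (powAct (lact k H V) n).flip t) (incH δ) r (fun i => ℛ k _) (fun i => ℛ k _)
      simp only [LinearMap.comp_apply, LinearMap.flip_apply, AlgHom.toLinearMap_apply,
        lact_apply] at coassoc
      rw [toTensorAlgebra_consEquiv, map_mul, ← mul_assoc, incH_mul_incV_ι δ r, Finset.sum_mul]
      simp only [mul_assoc, ih (ℛ k _), powAct_consEquiv _ n (ℛ k _), map_sum,
        toTensorAlgebra_consEquiv, map_mul, Finset.sum_mul, Finset.mul_sum, lact_apply]
        at coassoc ⊢
      exact coassoc.symm

theorem incF_mul_incH (n : ℕ) {ι : Type v} {h : H} (r : Coalgebra.Repr k h ι)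
    (u : ⨂[k]^n (Module.Dual k V)) :
    incF δ (TensorPower.toTensorAlgebra u) * incH δ h =
      ∑ i ∈ r.index, incH δ (r.left i) *
        incF δ (TensorPower.toTensorAlgebra (powAct (ract k H V) n (r.right i) u)) := by
  induction n generalizing h with
  | zero =>
    simp only [powAct_zero_apply, map_smul, mul_smul_comm, ← smul_mul_assoc, ← Finset.sum_mul,
      sum_smul_counit_map]
    rw [toTensorAlgebra_zero, AlgHom.commutes, Algebra.commutes]
  | succ n ih =>
    induction u using consEquiv_induction with
    | add x y hx hy => simp only [map_add, mul_add, add_mul, hx, hy, Finset.sum_add_distrib]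
    | cons f t =>
      have coassoc := sum_sum_mul_coassoc (incH δ) ((incF δ).toLinearMap ∘ₗ TensorAlgebra.ι k ∘ₗ
          (ract k H V).flip f) ((incF δ).toLinearMap ∘ₗ TensorPower.toTensorAlgebra ∘ₗ
          (powAct (ract k H V) n).flip t) r (fun i => ℛ k _) (fun i => ℛ k _)
      simp only [LinearMap.comp_apply, LinearMap.flip_apply, AlgHom.toLinearMap_apply] at coassoc
      rw [toTensorAlgebra_consEquiv, map_mul, mul_assoc, ih r, Finset.mul_sum]
      simp only [← mul_assoc, incF_ι_mul_incH δ (ℛ k _)]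
      simp only [mul_assoc, powAct_consEquiv _ n (ℛ k _), map_sum,
        toTensorAlgebra_consEquiv, map_mul, Finset.sum_mul, Finset.mul_sum] at coassoc ⊢
      exact coassoc

end CommutationRules

/-! ### Commutators as contractions of quasibraided integers -/

section Commutators

variable {k : Type u} {H : Type v} {V : Type w} [Field k] [Ring H] [Bialgebra k H]
variable [AddCommGroup V] [Module k V] [Module H V] [IsScalarTower k H V]
variable (δ : V →ₗ[k] H ⊗[k] V)

/-- The contraction `t ⊗ h ⊗ v ↦ ⟨f, v⟩ t h`, with values in the double. -/
def contractV (n : ℕ) (f : Module.Dual k V) : (⨂[k]^n V) ⊗[k] (H ⊗[k] V) →ₗ[k] FreeDouble δ :=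
  LinearMap.mul' k _ ∘ₗ TensorProduct.map ((incV δ).toLinearMap ∘ₗ TensorPower.toTensorAlgebra)
    (incH δ ∘ₗ (TensorProduct.rid k H).toLinearMap ∘ₗ LinearMap.lTensor H f)

theorem contractV_tmul (n : ℕ) (f : Module.Dual k V) (t : ⨂[k]^n V) (h : H) (v : V) :
    contractV δ n f (t ⊗ₜ (h ⊗ₜ v)) =
      f v • (incV δ (TensorPower.toTensorAlgebra t) * incH δ h) := by
  simp [contractV]

theorem contractV_headTerm (n : ℕ) (f : Module.Dual k V) (v : V) (t : ⨂[k]^n V) :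
    contractV δ n f (headTerm δ n (v ⊗ₜ t)) =
      incH δ (pairing δ f v) * incV δ (TensorPower.toTensorAlgebra t) := by
  simp only [headTerm, pairing, LinearMap.comp_apply, LinearMap.rTensor_tmul,
    LinearEquiv.coe_coe]
  induction δ v using TensorProduct.induction_on with
  | zero => simp
  | add x y hx hy => simp only [map_add, TensorProduct.add_tmul, add_mul, hx, hy]
  | tmul h w =>
    rw [LinearMap.rTensor_tmul, ← (ℛ k h).eq, LinearMap.lTensor_tmul, TensorProduct.rid_tmul,
      map_smul, smul_mul_assoc, incH_mul_incV δ n (ℛ k h)]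
    simp [TensorProduct.sum_tmul, contractV_tmul, Finset.smul_sum]

theorem contractV_consEquiv (n : ℕ) (f : Module.Dual k V) (v : V)
    (z : (⨂[k]^n V) ⊗[k] (H ⊗[k] V)) :
    contractV δ (n + 1) f (LinearMap.rTensor (H ⊗[k] V) (consEquiv k V n).toLinearMap
      ((TensorProduct.assoc k V (⨂[k]^n V) (H ⊗[k] V)).symm (v ⊗ₜ z))) =
      incV δ (TensorAlgebra.ι k v) * contractV δ n f z := by
  induction z using TensorProduct.induction_on with
  | zero => simp
  | add x y hx hy => simp only [map_add, TensorProduct.tmul_add, mul_add, hx, hy]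
  | tmul t y => simp [contractV, toTensorAlgebra_consEquiv, mul_assoc]

theorem incF_ι_mul_incV (n : ℕ) (f : Module.Dual k V) (u : ⨂[k]^(n + 1) V) :
    incF δ (TensorAlgebra.ι k f) * incV δ (TensorPower.toTensorAlgebra u) =
      incV δ (TensorPower.toTensorAlgebra u) * incF δ (TensorAlgebra.ι k f) +
        contractV δ n f (quasiInt δ n u) := by
  induction n with
  | zero =>
    induction u using consEquiv_induction with
    | add x y hx hy => simp only [map_add, mul_add, add_mul, hx, hy]; abel
    | cons v t =>
      rw [toTensorAlgebra_consEquiv, map_mul, ← mul_assoc, incF_ι_mul_incV_ι, add_mul,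
        ← contractV_headTerm]
      simp only [quasiInt, LinearMap.comp_apply, LinearEquiv.coe_coe, LinearEquiv.symm_apply_apply,
        toTensorAlgebra_zero, AlgHom.commutes, mul_assoc, Algebra.commutes]
  | succ n ih =>
    induction u using consEquiv_induction with
    | add x y hx hy => simp only [map_add, mul_add, add_mul, hx, hy]; abel
    | cons v t =>
      rw [toTensorAlgebra_consEquiv, map_mul, ← mul_assoc, incF_ι_mul_incV_ι, add_mul, mul_assoc,
        ih]
      simp only [quasiInt, LinearMap.comp_apply, LinearEquiv.coe_coe, LinearEquiv.symm_apply_apply,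
        LinearMap.add_apply, map_add, LinearMap.lTensor_tmul, contractV_headTerm,
        contractV_consEquiv, mul_add, mul_assoc]
      abel

/-- The contraction `f ⊗ h ⊗ s ↦ ⟨f, v⟩ h s`, with values in the double. -/
def contractF (n : ℕ) (v : V) :
    (Module.Dual k V ⊗[k] H) ⊗[k] (⨂[k]^n (Module.Dual k V)) →ₗ[k] FreeDouble δ :=
  LinearMap.mul' k _ ∘ₗ TensorProduct.map
    (incH δ ∘ₗ (TensorProduct.lid k H).toLinearMap ∘ₗ LinearMap.rTensor H (Module.Dual.eval k V v))
    ((incF δ).toLinearMap ∘ₗ TensorPower.toTensorAlgebra)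

theorem contractF_tmul (n : ℕ) (v : V) (f : Module.Dual k V) (h : H)
    (t : ⨂[k]^n (Module.Dual k V)) :
    contractF δ n v ((f ⊗ₜ h) ⊗ₜ t) =
      f v • (incH δ h * incF δ (TensorPower.toTensorAlgebra t)) := by
  simp [contractF]

theorem contractF_snocEquiv (n : ℕ) (v : V) (f : Module.Dual k V)
    (z : (Module.Dual k V ⊗[k] H) ⊗[k] (⨂[k]^n (Module.Dual k V))) :
    contractF δ (n + 1) v (LinearMap.lTensor (Module.Dual k V ⊗[k] H)
      (snocEquiv k (Module.Dual k V) n).toLinearMap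
      (TensorProduct.assoc k (Module.Dual k V ⊗[k] H) (⨂[k]^n (Module.Dual k V))
        (Module.Dual k V) (z ⊗ₜ f))) =
      contractF δ n v z * incF δ (TensorAlgebra.ι k f) := by
  induction z using TensorProduct.induction_on with
  | zero => simp
  | add x y hx hy => simp only [map_add, TensorProduct.add_tmul, add_mul, hx, hy]
  | tmul y t => simp [contractF, toTensorAlgebra_snocEquiv, mul_assoc]

variable [Module.Finite k V]

omit [Module H V] [IsScalarTower k H V] in
theorem dualTensorHom_rightQuasicoaction (f : Module.Dual k V) :
    dualTensorHom k V H (rightQuasicoaction δ f) = pairing δ f :=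
  LinearEquiv.apply_symm_apply (dualTensorHomEquiv k V H) (pairing δ f)

theorem contractF_tailTerm (n : ℕ) (v : V) (f : Module.Dual k V)
    (t : ⨂[k]^n (Module.Dual k V)) :
    contractF δ n v (tailTerm δ n (t ⊗ₜ f)) =
      incF δ (TensorPower.toTensorAlgebra t) * incH δ (pairing δ f v) := by
  simp only [← dualTensorHom_rightQuasicoaction, tailTerm, LinearMap.comp_apply,
    LinearMap.lTensor_tmul, LinearEquiv.coe_coe]
  induction rightQuasicoaction δ f using TensorProduct.induction_on with
  | zero => simp
  | add x y hx hy =>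
    simp only [map_add, TensorProduct.tmul_add, mul_add, hx, hy, LinearMap.add_apply]
  | tmul g h =>
    rw [LinearMap.lTensor_tmul, ← (ℛ k h).eq, dualTensorHom_apply, map_smul, mul_smul_comm,
      incF_mul_incH δ n (ℛ k h)]
    simp [TensorProduct.tmul_sum, contractF_tmul, Finset.smul_sum]

theorem incF_mul_incV_ι (n : ℕ) (v : V) (u : ⨂[k]^(n + 1) (Module.Dual k V)) :
    incF δ (TensorPower.toTensorAlgebra u) * incV δ (TensorAlgebra.ι k v) =
      incV δ (TensorAlgebra.ι k v) * incF δ (TensorPower.toTensorAlgebra u) +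
        contractF δ n v (quasiIntRight δ n u) := by
  induction n with
  | zero =>
    induction u using snocEquiv_induction with
    | add x y hx hy => simp only [map_add, mul_add, add_mul, hx, hy]; abel
    | snoc t f =>
      rw [toTensorAlgebra_snocEquiv, map_mul, mul_assoc, incF_ι_mul_incV_ι, mul_add,
        ← contractF_tailTerm]
      simp only [quasiIntRight, LinearMap.comp_apply, LinearEquiv.coe_coe,
        LinearEquiv.symm_apply_apply, toTensorAlgebra_zero, AlgHom.commutes, Algebra.commutes,
        mul_assoc]
  | succ n ih =>
    induction u using snocEquiv_induction with
    | add x y hx hy => simp only [map_add, mul_add, add_mul, hx, hy]; abel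
    | snoc t f =>
      rw [toTensorAlgebra_snocEquiv, map_mul, mul_assoc, incF_ι_mul_incV_ι, mul_add, ← mul_assoc,
        ih]
      simp only [quasiIntRight, LinearMap.comp_apply, LinearEquiv.coe_coe,
        LinearEquiv.symm_apply_apply, LinearMap.add_apply, map_add, LinearMap.rTensor_tmul,
        contractF_tailTerm, contractF_snocEquiv, add_mul, mul_assoc]
      abel

end Commutators

section LowerBound

variable {k : Type u} {H : Type v} {V : Type w} [Field k] [Ring H] [Bialgebra k H]
variable [AddCommGroup V] [Module k V] [Module H V] [IsScalarTower k H V]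
variable {δ : V →ₗ[k] H ⊗[k] V}

theorem idealV_isTwoSided : (idealV δ).IsTwoSided :=
  inferInstanceAs ((sumTriangular δ).comap (incV δ)).IsTwoSided

theorem idealF_isTwoSided : (idealF δ).IsTwoSided :=
  inferInstanceAs ((sumTriangular δ).comap (incF δ)).IsTwoSided

variable (hδ : IsQuasiYD δ)

theorem projV_contractV (n : ℕ) (g : Module.Dual k H) (f : Module.Dual k V)
    (z : (⨂[k]^n V) ⊗[k] (H ⊗[k] V)) :
    projV hδ g (contractV δ n f z) = TensorPower.toTensorAlgebra
      (sliceRight _ (TensorProduct.dualDistrib k H V (g ⊗ₜ f)) z) := by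
  revert z
  refine LinearMap.congr_fun (f := projV hδ g ∘ₗ contractV δ n f)
    (g := TensorPower.toTensorAlgebra ∘ₗ sliceRight _ _) ?_
  ext t h v
  simp [contractV_tmul, projV_incV_mul_incH, smul_smul, mul_comm]

theorem projF_contractF (n : ℕ) (g : Module.Dual k H) (v : V)
    (z : (Module.Dual k V ⊗[k] H) ⊗[k] (⨂[k]^n (Module.Dual k V))) :
    projF hδ g (contractF δ n v z) = TensorPower.toTensorAlgebra
      (sliceLeft _ (TensorProduct.dualDistrib k _ H (Module.Dual.eval k V v ⊗ₜ g)) z) := by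
  revert z
  refine LinearMap.congr_fun (f := projF hδ g ∘ₗ contractF δ n v)
    (g := TensorPower.toTensorAlgebra ∘ₗ sliceLeft _ _) ?_
  ext f h t
  simp [contractF_tmul, projF_incH_mul_incF, smul_smul]

include hδ

theorem powAct_lact_mem_idealV (n : ℕ) (h : H) (t : ⨂[k]^n V)
    (ht : TensorPower.toTensorAlgebra t ∈ idealV δ) :
    TensorPower.toTensorAlgebra (powAct (lact k H V) n h t) ∈ idealV δ := by
  have h_proj := (hasTriangularForm_sumTriangular hδ).projV_mem hδ Coalgebra.counit
    (Ideal.mul_mem_left _ (incH δ h) ht)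
  rw [incH_mul_incV δ n (ℛ k h), map_sum] at h_proj
  simp only [projV_incV_mul_incH] at h_proj
  exact sum_smul_counit_map
    (TensorPower.toTensorAlgebra ∘ₗ (powAct (lact k H V) n).flip t) (ℛ k h) ▸ h_proj

theorem powAct_ract_mem_idealF (n : ℕ) (h : H) (t : ⨂[k]^n (Module.Dual k V))
    (ht : TensorPower.toTensorAlgebra t ∈ idealF δ) :
    TensorPower.toTensorAlgebra (powAct (ract k H V) n h t) ∈ idealF δ := by
  have h_proj := (hasTriangularForm_sumTriangular hδ).projF_mem hδ Coalgebra.counit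
    (Ideal.mul_mem_right (incH δ h) _ ht)
  rw [incF_mul_incH δ n (ℛ k h), map_sum] at h_proj
  simp only [projF_incH_mul_incF] at h_proj
  exact sum_counit_smul_map
    (TensorPower.toTensorAlgebra ∘ₗ (powAct (ract k H V) n).flip t) (ℛ k h) ▸ h_proj

theorem sliceRight_quasiInt_mem_idealV {n : ℕ} {u : ⨂[k]^(n + 1) V}
    (hu : TensorPower.toTensorAlgebra u ∈ idealV δ) (g : Module.Dual k H) (f : Module.Dual k V) :
    TensorPower.toTensorAlgebra (sliceRight _ (TensorProduct.dualDistrib k H V (g ⊗ₜ f))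
      (quasiInt δ n u)) ∈ idealV δ := by
  have h_proj := (hasTriangularForm_sumTriangular hδ).projV_mem hδ g
    (Ideal.mul_mem_left _ (incF δ (TensorAlgebra.ι k f)) hu)
  have h_zero := projV_mul_mul hδ g (TensorPower.toTensorAlgebra u) 1 (TensorAlgebra.ι k f)
  rw [incH_one, mul_one, TensorAlgebra.algebraMapInv, TensorAlgebra.lift_ι_apply,
    LinearMap.zero_apply, mul_zero, zero_smul] at h_zero
  rwa [incF_ι_mul_incV, map_add, h_zero, zero_add, projV_contractV] at h_proj

theorem sliceLeft_quasiIntRight_mem_idealF [Module.Finite k V] {n : ℕ}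
    {u : ⨂[k]^(n + 1) (Module.Dual k V)} (hu : TensorPower.toTensorAlgebra u ∈ idealF δ)
    (v : V) (g : Module.Dual k H) :
    TensorPower.toTensorAlgebra (sliceLeft _
      (TensorProduct.dualDistrib k _ H (Module.Dual.eval k V v ⊗ₜ g))
      (quasiIntRight δ n u)) ∈ idealF δ := by
  have h_proj := (hasTriangularForm_sumTriangular hδ).projF_mem hδ g
    (Ideal.mul_mem_right (incV δ (TensorAlgebra.ι k v)) _ hu)
  have h_zero := projF_mul_mul hδ g (TensorAlgebra.ι k v) 1 (TensorPower.toTensorAlgebra u)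
  rw [incH_one, mul_one, TensorAlgebra.algebraMapInv, TensorAlgebra.lift_ι_apply,
    LinearMap.zero_apply, zero_mul, zero_smul] at h_zero
  rwa [incF_mul_incV_ι, map_add, h_zero, zero_add, projF_contractF] at h_proj

theorem quasiFactorial_eq_zero (n : ℕ) (u : ⨂[k]^n V)
    (hu : TensorPower.toTensorAlgebra u ∈ idealV δ) : quasiFactorial δ n u = 0 := by
  induction n with
  | zero =>
    rw [eq_zero_of_toTensorAlgebra_mem_posPart ((hasTriangularForm_sumTriangular hδ).minus_le hu),
      map_zero]
  | succ n ih =>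
    have h_succ : LinearMap.rTensor (H ⊗[k] V) (quasiFactorial δ n) (quasiInt δ n u) = 0 :=
      eq_zero_of_sliceRight fun g f => by
        rw [sliceRight_rTensor, ih _ (sliceRight_quasiInt_mem_idealV hδ hu g f)]
    simp only [quasiFactorial, LinearMap.comp_apply, h_succ, map_zero]

theorem quasiFactorialRight_eq_zero [Module.Finite k V] (n : ℕ) (u : ⨂[k]^n (Module.Dual k V))
    (hu : TensorPower.toTensorAlgebra u ∈ idealF δ) : quasiFactorialRight δ n u = 0 := by
  induction n with
  | zero =>
    rw [eq_zero_of_toTensorAlgebra_mem_posPart ((hasTriangularForm_sumTriangular hδ).plus_le hu),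
      map_zero]
  | succ n ih =>
    have h_succ : LinearMap.lTensor (Module.Dual k V ⊗[k] H) (quasiFactorialRight δ n)
        (quasiIntRight δ n u) = 0 :=
      eq_zero_of_sliceLeft fun φ g => by
        obtain ⟨v, rfl⟩ := (Module.bijective_dual_eval k V).2 φ
        rw [sliceLeft_lTensor, ih _ (sliceLeft_quasiIntRight_mem_idealF hδ hu v g)]
    simp only [quasiFactorialRight, LinearMap.comp_apply, h_succ, map_zero]

end LowerBound

/-! ### Free doubles over a Hopf algebra -/

section GeneratedIdeals

variable {k A : Type*} [CommSemiring k] [Ring A] [Algebra k A]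

/-- The two-sided ideal generated by a subspace. -/
def idealSpan (K : Submodule k A) : Ideal A where
  toAddSubmonoid := (⊤ * K * ⊤ : Submodule k A).toAddSubmonoid
  smul_mem' b x hx := by
    have h : (⊤ : Submodule k A) * (⊤ * K * ⊤) ≤ ⊤ * K * ⊤ := by
      rw [← mul_assoc, ← mul_assoc]
      grw [le_top (a := (⊤ : Submodule k A) * ⊤)]
    exact h (Submodule.mul_mem_mul (Submodule.mem_top (x := b)) hx)

theorem restrictScalars_idealSpan (K : Submodule k A) :
    (idealSpan K).restrictScalars k = ⊤ * K * ⊤ := rfl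

instance (K : Submodule k A) : (idealSpan K).IsTwoSided where
  mul_mem_of_left {x} b hx := by
    have h : (⊤ * K * ⊤ : Submodule k A) * ⊤ ≤ ⊤ * K * ⊤ := by
      rw [mul_assoc]
      grw [le_top (a := (⊤ : Submodule k A) * ⊤)]
    exact h (Submodule.mul_mem_mul hx (Submodule.mem_top (x := b)))

theorem mem_idealSpan_of_mem {K : Submodule k A} {x : A} (hx : x ∈ K) : x ∈ idealSpan K := by
  rw [← Submodule.restrictScalars_mem k]
  simpa [restrictScalars_idealSpan] using Submodule.mul_mem_mul
    (Submodule.mul_mem_mul (Submodule.mem_top (x := (1 : A))) hx)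
    (Submodule.mem_top (R := k) (x := (1 : A)))

variable {P Q R K W : Submodule k A}

theorem top_mul_mul_top_le_mul_mul (h_top : P * Q * R = ⊤) (hRK : R * K ≤ K * Q * R)
    (hQK : Q * K ≤ W * Q) (hPW : P * W ≤ W) (hWP : W * P ≤ W) : ⊤ * K * ⊤ ≤ W * Q * R :=
  calc ⊤ * K * ⊤ = P * Q * (R * K) * ⊤ := by rw [← h_top]; simp only [mul_assoc]
    _ ≤ P * Q * (K * Q * R) * ⊤ := by grw [hRK]
    _ = P * (Q * K) * (Q * R * ⊤) := by simp only [mul_assoc]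
    _ ≤ P * (W * Q) * ⊤ := by grw [hQK, le_top (a := Q * R * ⊤)]
    _ = P * W * (Q * ⊤) := by simp only [mul_assoc]
    _ ≤ W * (P * Q * R) := by grw [hPW, h_top, le_top (a := Q * ⊤)]
    _ = W * P * Q * R := by simp only [mul_assoc]
    _ ≤ W * Q * R := by grw [hWP]

theorem top_mul_mul_top_le_mul_mul' (h_top : P * Q * R = ⊤) (hKP : K * P ≤ P * Q * K)
    (hKQ : K * Q ≤ Q * W) (hWR : W * R ≤ W) (hRW : R * W ≤ W) : ⊤ * K * ⊤ ≤ P * Q * W :=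
  calc ⊤ * K * ⊤ = ⊤ * (K * P) * (Q * R) := by rw [← h_top]; simp only [mul_assoc]
    _ ≤ ⊤ * (P * Q * K) * (Q * R) := by grw [hKP]
    _ = ⊤ * P * Q * (K * Q) * R := by simp only [mul_assoc]
    _ ≤ ⊤ * (Q * W) * R := by grw [hKQ, le_top (a := ⊤ * P * Q)]
    _ = ⊤ * Q * (W * R) := by simp only [mul_assoc]
    _ ≤ P * Q * R * W := by grw [hWR, h_top, le_top (a := ⊤ * Q)]
    _ = P * Q * (R * W) := by simp only [mul_assoc]
    _ ≤ P * Q * W := by grw [hRW]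

end GeneratedIdeals

section TensorAlgebraIdeals

variable {k : Type u} {M : Type x} [Field k] [AddCommGroup M] [Module k M]
variable {A : Type*} [Ring A] [Algebra k A] (φ : TensorAlgebra k M →ₐ[k] A)

theorem range_mul_le {Q : Submodule k A}
    (hQ : LinearMap.range (φ.toLinearMap ∘ₗ TensorAlgebra.ι k) * Q ≤ Q) :
    LinearMap.range φ.toLinearMap * Q ≤ Q := by
  rw [Submodule.mul_le]
  rintro _ ⟨t, rfl⟩ q hq
  induction t using TensorAlgebra.induction generalizing q with
  | algebraMap c => simpa [← Algebra.smul_def] using Q.smul_mem c hq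
  | ι m => exact hQ (Submodule.mul_mem_mul ⟨m, rfl⟩ hq)
  | mul a b ha hb => simpa [mul_assoc] using ha _ (hb q hq)
  | add a b ha hb => simpa [add_mul] using add_mem (ha q hq) (hb q hq)

theorem mul_range_le {Q : Submodule k A}
    (hQ : Q * LinearMap.range (φ.toLinearMap ∘ₗ TensorAlgebra.ι k) ≤ Q) :
    Q * LinearMap.range φ.toLinearMap ≤ Q := by
  rw [Submodule.mul_le]
  rintro q hq _ ⟨t, rfl⟩
  induction t using TensorAlgebra.induction generalizing q with
  | algebraMap c =>
    simpa [← Algebra.commutes, ← Algebra.smul_def] using Q.smul_mem c hq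
  | ι m => exact hQ (Submodule.mul_mem_mul hq ⟨m, rfl⟩)
  | mul a b ha hb => simpa [mul_assoc] using hb _ (ha q hq)
  | add a b ha hb => simpa [mul_add] using add_mem (ha q hq) (hb q hq)

/-- The positive part `T^{>0}(M) ∩ φ⁻¹(J)` of the preimage of an ideal under `φ : T(M) → A`. -/
def posComap (J : Ideal A) : Submodule k (TensorAlgebra k M) :=
  (J.comap φ).restrictScalars k ⊓ posPart k M

variable {φ} {J : Ideal A}

theorem range_mul_map_posComap_le : LinearMap.range φ.toLinearMap *
    (posComap φ J).map φ.toLinearMap ≤ (posComap φ J).map φ.toLinearMap := by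
  refine Submodule.mul_le.2 ?_
  rintro _ ⟨t, rfl⟩ _ ⟨a, ⟨haJ, ha_pos⟩, rfl⟩
  have augmentation_eq_zero : TensorAlgebra.algebraMapInv a = 0 := ha_pos
  exact ⟨t * a, ⟨Ideal.mul_mem_left _ t haJ, by simp [posPart, augmentation_eq_zero]⟩,
    map_mul φ t a⟩

theorem map_posComap_mul_range_le [J.IsTwoSided] : (posComap φ J).map φ.toLinearMap *
    LinearMap.range φ.toLinearMap ≤ (posComap φ J).map φ.toLinearMap := by
  refine Submodule.mul_le.2 ?_
  rintro _ ⟨a, ⟨haJ, ha_pos⟩, rfl⟩ _ ⟨t, rfl⟩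
  have augmentation_eq_zero : TensorAlgebra.algebraMapInv a = 0 := ha_pos
  exact ⟨a * t, ⟨Ideal.mul_mem_right t _ haJ, by simp [posPart, augmentation_eq_zero]⟩,
    map_mul φ a t⟩

variable {C : ∀ n, Submodule k (⨂[k]^n M)}

theorem mul_map_gradedSpan_le {X Y : Submodule k A}
    (h : ∀ x ∈ X, ∀ n, ∀ u ∈ C (n + 1), x * φ (TensorPower.toTensorAlgebra u) ∈ Y) :
    X * (gradedSpan C).map φ.toLinearMap ≤ Y := by
  refine Submodule.mul_le.2 fun x hx => ?_
  rintro _ ⟨t, ht, rfl⟩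
  exact gradedSpan_le (S := Y.comap (LinearMap.mulLeft k x ∘ₗ φ.toLinearMap)) (h x hx) ht

theorem map_gradedSpan_mul_le {X Y : Submodule k A}
    (h : ∀ n, ∀ u ∈ C (n + 1), ∀ x ∈ X, φ (TensorPower.toTensorAlgebra u) * x ∈ Y) :
    (gradedSpan C).map φ.toLinearMap * X ≤ Y := by
  refine Submodule.mul_le.2 ?_
  rintro _ ⟨t, ht, rfl⟩ x hx
  exact gradedSpan_le (S := Y.comap (LinearMap.mulRight k x ∘ₗ φ.toLinearMap))
    (fun n u hu => h n u hu x hx) ht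

theorem toTensorAlgebra_mem_posComap {n : ℕ} {u : ⨂[k]^(n + 1) M}
    (hu : φ (TensorPower.toTensorAlgebra u) ∈ J) : TensorPower.toTensorAlgebra u ∈ posComap φ J :=
  ⟨hu, mem_posPart_of_mem n.succ_ne_zero ((range_toTensorAlgebra _).le ⟨u, rfl⟩)⟩

end TensorAlgebraIdeals

section Antipode

variable {k : Type u} {H : Type v} {V : Type w} [Field k] [Ring H] [Bialgebra k H]

theorem IsHopf.exists_antipode (hH : IsHopf k H) : ∃ S : H →ₗ[k] H,
    ∀ (h : H) (r : Coalgebra.Repr k h (H × H)),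
      ∑ i ∈ r.index, S (r.left i) * r.right i = algebraMap k H (Coalgebra.counit h) ∧
      ∑ i ∈ r.index, r.left i * S (r.right i) = algebraMap k H (Coalgebra.counit h) := by
  obtain ⟨A, rfl⟩ := hH
  exact ⟨HopfAlgebra.antipode k, fun h r =>
    ⟨HopfAlgebra.sum_antipode_mul_eq_algebraMap_counit r,
      HopfAlgebra.sum_mul_antipode_eq_algebraMap_counit r⟩⟩

variable [AddCommGroup V] [Module k V] [Module H V] [IsScalarTower k H V]
variable {δ : V →ₗ[k] H ⊗[k] V} {J : Ideal (FreeDouble δ)} [J.IsTwoSided] {n : ℕ}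

/- In the double, `h ▷ u = h₍₁₎ u S(h₍₂₎)` and `u ◁ h = S(h₍₁₎) u h₍₂₎`. -/
theorem incV_powAct_mem (hH : IsHopf k H) {u : ⨂[k]^n V}
    (hu : incV δ (TensorPower.toTensorAlgebra u) ∈ J) (h : H) :
    incV δ (TensorPower.toTensorAlgebra (powAct (lact k H V) n h u)) ∈ J := by
  obtain ⟨S, hS⟩ := hH.exists_antipode
  let act : H →ₗ[k] FreeDouble δ := (incV δ).toLinearMap ∘ₗ TensorPower.toTensorAlgebra ∘ₗ
    (powAct (lact k H V) n).flip u
  have coassoc := sum_sum_mul_coassoc act (incH δ) (incH δ ∘ₗ S) (ℛ k h) (fun i => ℛ k _)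
    (fun i => ℛ k _)
  have conj_eq : ∑ i ∈ (ℛ k h).index, incH δ ((ℛ k h).left i) *
      incV δ (TensorPower.toTensorAlgebra u) * incH δ (S ((ℛ k h).right i)) = act h := by
    rw [← sum_smul_counit_map act (ℛ k h)]
    simp only [LinearMap.comp_apply, mul_assoc, ← incH_mul, ← Finset.mul_sum, ← map_sum,
      (hS _ _).2, Algebra.algebraMap_eq_smul_one, map_smul, incH_one, mul_smul_comm,
      mul_one] at coassoc
    rw [← coassoc]
    simp only [incH_mul_incV δ n (ℛ k _), incH_mul, Finset.sum_mul, mul_assoc]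
    rfl
  change act h ∈ J
  rw [← conj_eq]
  exact sum_mem fun i _ => J.mul_mem_right _ (J.mul_mem_left _ hu)

theorem incF_powAct_mem (hH : IsHopf k H) {u : ⨂[k]^n (Module.Dual k V)}
    (hu : incF δ (TensorPower.toTensorAlgebra u) ∈ J) (h : H) :
    incF δ (TensorPower.toTensorAlgebra (powAct (ract k H V) n h u)) ∈ J := by
  obtain ⟨S, hS⟩ := hH.exists_antipode
  let act : H →ₗ[k] FreeDouble δ := (incF δ).toLinearMap ∘ₗ TensorPower.toTensorAlgebra ∘ₗ
    (powAct (ract k H V) n).flip u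
  have coassoc := sum_sum_mul_coassoc (incH δ ∘ₗ S) (incH δ) act (ℛ k h) (fun i => ℛ k _)
    (fun i => ℛ k _)
  have conj_eq : ∑ i ∈ (ℛ k h).index, incH δ (S ((ℛ k h).left i)) *
      (incF δ (TensorPower.toTensorAlgebra u) * incH δ ((ℛ k h).right i)) = act h := by
    rw [← sum_counit_smul_map act (ℛ k h)]
    simp only [LinearMap.comp_apply, ← incH_mul, ← Finset.sum_mul, ← map_sum,
      (hS _ _).1, Algebra.algebraMap_eq_smul_one, map_smul, incH_one, smul_mul_assoc,
      one_mul] at coassoc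
    rw [coassoc]
    simp only [incF_mul_incH δ n (ℛ k _), incH_mul, Finset.mul_sum, mul_assoc]
    rfl
  change act h ∈ J
  rw [← conj_eq]
  exact sum_mem fun i _ => J.mul_mem_left _ (J.mul_mem_right _ hu)

end Antipode

section UpperBound

variable {k : Type u} {H : Type v} {V : Type w} [Field k] [Ring H] [Bialgebra k H]
variable [AddCommGroup V] [Module k V] [Module H V] [IsScalarTower k H V]
variable {δ : V →ₗ[k] H ⊗[k] V}

section Minus

variable {C : ∀ n, Submodule k (⨂[k]^n V)} (hC : ∀ n, ∀ u ∈ C (n + 1), ∀ f,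
  contractV δ n f (quasiInt δ n u) ∈ (gradedSpan C).map (incV δ).toLinearMap * rangeH δ)

include hC

theorem range_incF_ι_mul_map_gradedSpan_le :
    LinearMap.range ((incF δ).toLinearMap ∘ₗ TensorAlgebra.ι k) *
      (gradedSpan C).map (incV δ).toLinearMap ≤
    (gradedSpan C).map (incV δ).toLinearMap * rangeHF δ := by
  refine mul_map_gradedSpan_le ?_
  rintro _ ⟨f, rfl⟩ n u hu
  rw [LinearMap.comp_apply, AlgHom.toLinearMap_apply, incF_ι_mul_incV]
  exact add_mem
    (Submodule.mul_mem_mul (Submodule.mem_map_of_mem (toTensorAlgebra_mem_gradedSpan hu))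
      (Submodule.mem_sup_right ⟨f, rfl⟩))
    (mul_le_mul_right (le_sup_left : rangeH δ ≤ rangeHF δ) _ (hC n u hu f))

theorem rangeF_mul_map_gradedSpan_le : rangeF δ * (gradedSpan C).map (incV δ).toLinearMap ≤
    (gradedSpan C).map (incV δ).toLinearMap * rangeH δ * rangeF δ := by
  set K := (gradedSpan C).map (incV δ).toLinearMap
  set F₁ := LinearMap.range ((incF δ).toLinearMap ∘ₗ TensorAlgebra.ι k)
  have stable : F₁ * (K * rangeH δ * rangeF δ) ≤ K * rangeH δ * rangeF δ :=
    calc F₁ * (K * rangeH δ * rangeF δ)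
        = F₁ * K * rangeH δ * rangeF δ := by simp only [mul_assoc]
      _ ≤ K * rangeHF δ * rangeH δ * rangeF δ := by
        grw [range_incF_ι_mul_map_gradedSpan_le hC]
      _ = K * (rangeHF δ * rangeH δ) * rangeF δ := by simp only [mul_assoc]
      _ ≤ K * (rangeH δ * rangeF δ) * rangeF δ := by grw [rangeHF_mul_rangeH_le]
      _ = K * rangeH δ * rangeF δ := by
        rw [mul_assoc, mul_assoc, range_mul_range, ← mul_assoc]
  have le_span : K ≤ K * rangeH δ * rangeF δ := by
    rw [mul_assoc]
    exact le_mul_of_one_le_right' (one_le_mul (one_le_rangeH δ) (one_le_range _))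
  exact (mul_le_mul_right le_span _).trans (range_mul_le (incF δ) stable)

omit hC in
theorem rangeH_mul_map_gradedSpan_le (hH : IsHopf k H) :
    rangeH δ * (gradedSpan C).map (incV δ).toLinearMap ≤
      (posComap (incV δ) (idealSpan ((gradedSpan C).map (incV δ).toLinearMap))).map
        (incV δ).toLinearMap * rangeH δ := by
  refine mul_map_gradedSpan_le ?_
  rintro _ ⟨h, rfl⟩ n u hu
  have incV_mem := mem_idealSpan_of_mem
    (Submodule.mem_map_of_mem (f := (incV δ).toLinearMap) (toTensorAlgebra_mem_gradedSpan hu))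
  rw [incH_mul_incV δ (n + 1) (ℛ k h)]
  exact sum_mem fun i _ => Submodule.mul_mem_mul
    (Submodule.mem_map_of_mem (f := (incV δ).toLinearMap)
      (toTensorAlgebra_mem_posComap (incV_powAct_mem hH incV_mem _))) ⟨_, rfl⟩

theorem hasTriangularForm_idealSpan_map_incV (hH : IsHopf k H) :
    HasTriangularForm δ (idealSpan ((gradedSpan C).map (incV δ).toLinearMap))
      (posComap (incV δ) (idealSpan ((gradedSpan C).map (incV δ).toLinearMap))) ⊥ :=
  .mk_of_le inferInstance inf_le_right bot_le (fun _ ht => ht.1) (fun s hs => by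
      rw [(Submodule.mem_bot k).1 hs, map_zero]; exact zero_mem _)
    ((top_mul_mul_top_le_mul_mul (rangeV_mul_rangeH_mul_rangeF δ)
      (rangeF_mul_map_gradedSpan_le hC) (rangeH_mul_map_gradedSpan_le hH)
      range_mul_map_posComap_le map_posComap_mul_range_le).trans le_sup_left)

theorem gradedSpan_le_idealV (hH : IsHopf k H) :
    gradedSpan C ≤ (idealV δ).restrictScalars k := by
  have le_sum : idealSpan ((gradedSpan C).map (incV δ).toLinearMap) ≤ sumTriangular δ :=
    IsTriangularIdeal.le_sumTriangular ⟨_, _, hasTriangularForm_idealSpan_map_incV hC hH⟩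
  intro t ht
  have incV_mem := mem_idealSpan_of_mem
    (Submodule.mem_map_of_mem (f := (incV δ).toLinearMap) ht)
  exact le_sum incV_mem

end Minus

section Plus

/-- The image of `H ⊕ V` in `Ã(V, δ)`; unlike `V`, it can be moved to the left past `H`. -/
abbrev rangeVH (δ : V →ₗ[k] H ⊗[k] V) : Submodule k (FreeDouble δ) :=
  rangeH δ ⊔ LinearMap.range ((incV δ).toLinearMap ∘ₗ TensorAlgebra.ι k)

theorem rangeH_mul_rangeVH_le (δ : V →ₗ[k] H ⊗[k] V) :
    rangeH δ * rangeVH δ ≤ rangeV δ * rangeH δ := by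
  rw [Submodule.mul_sup, rangeH_mul_rangeH, sup_le_iff]
  refine ⟨le_mul_of_one_le_left' (one_le_range _), Submodule.mul_le.2 ?_⟩
  rintro _ ⟨h, rfl⟩ _ ⟨v, rfl⟩
  exact incH_mul_incV_ι_mem δ h v

variable {C : ∀ n, Submodule k (⨂[k]^n (Module.Dual k V))}

theorem map_gradedSpan_mul_rangeH_le (hH : IsHopf k H) :
    (gradedSpan C).map (incF δ).toLinearMap * rangeH δ ≤
      rangeH δ * (posComap (incF δ)
        (idealSpan ((gradedSpan C).map (incF δ).toLinearMap))).map (incF δ).toLinearMap := by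
  refine map_gradedSpan_mul_le ?_
  rintro n u hu _ ⟨h, rfl⟩
  have incF_mem := mem_idealSpan_of_mem
    (Submodule.mem_map_of_mem (f := (incF δ).toLinearMap) (toTensorAlgebra_mem_gradedSpan hu))
  rw [incF_mul_incH δ (n + 1) (ℛ k h)]
  exact sum_mem fun i _ => Submodule.mul_mem_mul ⟨_, rfl⟩
    (Submodule.mem_map_of_mem (f := (incF δ).toLinearMap)
      (toTensorAlgebra_mem_posComap (incF_powAct_mem hH incF_mem _)))

variable [Module.Finite k V] (hC : ∀ n, ∀ u ∈ C (n + 1), ∀ v,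
  contractF δ n v (quasiIntRight δ n u) ∈ rangeH δ * (gradedSpan C).map (incF δ).toLinearMap)

include hC

theorem map_gradedSpan_mul_range_incV_ι_le :
    (gradedSpan C).map (incF δ).toLinearMap *
      LinearMap.range ((incV δ).toLinearMap ∘ₗ TensorAlgebra.ι k) ≤
    rangeVH δ * (gradedSpan C).map (incF δ).toLinearMap := by
  refine map_gradedSpan_mul_le ?_
  rintro n u hu _ ⟨v, rfl⟩
  rw [LinearMap.comp_apply, AlgHom.toLinearMap_apply, incF_mul_incV_ι]
  exact add_mem
    (Submodule.mul_mem_mul (Submodule.mem_sup_right ⟨v, rfl⟩)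
      (Submodule.mem_map_of_mem (toTensorAlgebra_mem_gradedSpan hu)))
    (mul_le_mul_left (le_sup_left : rangeH δ ≤ rangeVH δ) _ (hC n u hu v))

theorem map_gradedSpan_mul_rangeV_le : (gradedSpan C).map (incF δ).toLinearMap * rangeV δ ≤
    rangeV δ * rangeH δ * (gradedSpan C).map (incF δ).toLinearMap := by
  set K := (gradedSpan C).map (incF δ).toLinearMap
  set V₁ := LinearMap.range ((incV δ).toLinearMap ∘ₗ TensorAlgebra.ι k)
  have stable : rangeV δ * rangeH δ * K * V₁ ≤ rangeV δ * rangeH δ * K :=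
    calc rangeV δ * rangeH δ * K * V₁
        = rangeV δ * rangeH δ * (K * V₁) := by simp only [mul_assoc]
      _ ≤ rangeV δ * rangeH δ * (rangeVH δ * K) := by
        grw [map_gradedSpan_mul_range_incV_ι_le hC]
      _ = rangeV δ * (rangeH δ * rangeVH δ) * K := by simp only [mul_assoc]
      _ ≤ rangeV δ * (rangeV δ * rangeH δ) * K := by grw [rangeH_mul_rangeVH_le]
      _ = rangeV δ * rangeH δ * K := by rw [← mul_assoc, range_mul_range]
  have le_span : K ≤ rangeV δ * rangeH δ * K :=
    le_mul_of_one_le_left' (one_le_mul (one_le_range _) (one_le_rangeH δ))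
  exact (mul_le_mul_left le_span _).trans (mul_range_le (incV δ) stable)

theorem hasTriangularForm_idealSpan_map_incF (hH : IsHopf k H) :
    HasTriangularForm δ (idealSpan ((gradedSpan C).map (incF δ).toLinearMap)) ⊥
      (posComap (incF δ) (idealSpan ((gradedSpan C).map (incF δ).toLinearMap))) :=
  .mk_of_le inferInstance bot_le inf_le_right (fun t ht => by
      rw [(Submodule.mem_bot k).1 ht, map_zero]; exact zero_mem _) (fun _ hs => hs.1)
    ((top_mul_mul_top_le_mul_mul' (rangeV_mul_rangeH_mul_rangeF δ)
      (map_gradedSpan_mul_rangeV_le hC) (map_gradedSpan_mul_rangeH_le hH)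
      map_posComap_mul_range_le range_mul_map_posComap_le).trans le_sup_right)

theorem gradedSpan_le_idealF (hH : IsHopf k H) :
    gradedSpan C ≤ (idealF δ).restrictScalars k := by
  have le_sum : idealSpan ((gradedSpan C).map (incF δ).toLinearMap) ≤ sumTriangular δ :=
    IsTriangularIdeal.le_sumTriangular ⟨_, _, hasTriangularForm_idealSpan_map_incF hC hH⟩
  intro t ht
  have incF_mem := mem_idealSpan_of_mem
    (Submodule.mem_map_of_mem (f := (incF δ).toLinearMap) ht)
  exact le_sum incF_mem

end Plus

end UpperBound

section Exactness

variable {k M N P : Type*} [Field k] [AddCommMonoid M] [Module k M] [AddCommMonoid N] [Module k N]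
variable [AddCommMonoid P] [Module k P] {φ : M →ₗ[k] N}

/- `TensorPower` carries only an additive monoid structure, while exactness of `⊗` is stated for
additive groups. -/
theorem exists_rTensor_subtype_eq {w : M ⊗[k] P} (hw : LinearMap.rTensor P φ w = 0) :
    ∃ z : LinearMap.ker φ ⊗[k] P, LinearMap.rTensor P (LinearMap.ker φ).subtype z = w := by
  let _ := Module.addCommMonoidToAddCommGroup k (M := M)
  let _ := Module.addCommMonoidToAddCommGroup k (M := N)
  let _ := Module.addCommMonoidToAddCommGroup k (M := P)
  exact (Module.Flat.rTensor_exact P (LinearMap.exact_subtype_ker_map φ) w).1 hw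

theorem exists_lTensor_subtype_eq {w : P ⊗[k] M} (hw : LinearMap.lTensor P φ w = 0) :
    ∃ z : P ⊗[k] LinearMap.ker φ, LinearMap.lTensor P (LinearMap.ker φ).subtype z = w := by
  let _ := Module.addCommMonoidToAddCommGroup k (M := M)
  let _ := Module.addCommMonoidToAddCommGroup k (M := N)
  let _ := Module.addCommMonoidToAddCommGroup k (M := P)
  exact (Module.Flat.lTensor_exact P (LinearMap.exact_subtype_ker_map φ) w).1 hw

end Exactness

section FactorialKernels

variable {k : Type u} {H : Type v} {V : Type w} [Field k] [Ring H] [Bialgebra k H]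
variable [AddCommGroup V] [Module k V] [Module H V] [IsScalarTower k H V]
variable {δ : V →ₗ[k] H ⊗[k] V}

theorem ker_quasiFactorial_zero : LinearMap.ker (quasiFactorial δ 0) = ⊥ :=
  LinearEquiv.ker _

theorem rTensor_quasiFactorial_quasiInt {n : ℕ} {u : ⨂[k]^(n + 1) V}
    (hu : quasiFactorial δ (n + 1) u = 0) :
    LinearMap.rTensor (H ⊗[k] V) (quasiFactorial δ n) (quasiInt δ n u) = 0 :=
  (snocEquiv k (H ⊗[k] V) n).map_eq_zero_iff.1 hu

theorem contractV_rTensor_subtype_mem {n : ℕ} {D : Submodule k (⨂[k]^n V)}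
    (f : Module.Dual k V) (z : D ⊗[k] (H ⊗[k] V)) :
    contractV δ n f (LinearMap.rTensor (H ⊗[k] V) D.subtype z) ∈
      (D.map TensorPower.toTensorAlgebra).map (incV δ).toLinearMap * rangeH δ := by
  induction z using TensorProduct.induction_on with
  | zero => simp
  | add x y hx hy => simpa using add_mem hx hy
  | tmul t y =>
    induction y using TensorProduct.induction_on with
    | zero => simp
    | add x y hx hy => simpa only [TensorProduct.tmul_add, map_add] using add_mem hx hy
    | tmul h v =>
      rw [LinearMap.rTensor_tmul, contractV_tmul]
      exact Submodule.smul_mem _ _ (Submodule.mul_mem_mul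
        (Submodule.mem_map_of_mem (Submodule.mem_map_of_mem t.2)) ⟨h, rfl⟩)

theorem contractV_quasiInt_mem {n : ℕ} {u : ⨂[k]^(n + 1) V}
    (hu : quasiFactorial δ (n + 1) u = 0) (f : Module.Dual k V) :
    contractV δ n f (quasiInt δ n u) ∈
      (gradedSpan fun n => LinearMap.ker (quasiFactorial δ n)).map (incV δ).toLinearMap *
        rangeH δ := by
  obtain ⟨z, hz⟩ := exists_rTensor_subtype_eq (rTensor_quasiFactorial_quasiInt hu)
  rw [← hz]
  exact mul_le_mul_left (Submodule.map_mono
    (map_toTensorAlgebra_le_gradedSpan ker_quasiFactorial_zero n)) _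
    (contractV_rTensor_subtype_mem f z)

theorem idealV_eq_iSup_ker (hδ : IsQuasiYD δ) (hH : IsHopf k H) : (idealV δ).restrictScalars k =
    ⨆ n : ℕ, ⨆ _ : 1 ≤ n,
      (LinearMap.ker (quasiFactorial δ n)).map TensorPower.toTensorAlgebra :=
  le_antisymm
    (le_gradedSpan (idealV_isHomogeneous δ) (hasTriangularForm_sumTriangular hδ).minus_le
      (quasiFactorial_eq_zero hδ))
    (gradedSpan_le_idealV (fun _ _ hu => contractV_quasiInt_mem hu) hH)

variable [Module.Finite k V]

theorem ker_quasiFactorialRight_zero : LinearMap.ker (quasiFactorialRight δ 0) = ⊥ :=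
  LinearEquiv.ker _

theorem lTensor_quasiFactorialRight_quasiIntRight {n : ℕ} {u : ⨂[k]^(n + 1) (Module.Dual k V)}
    (hu : quasiFactorialRight δ (n + 1) u = 0) :
    LinearMap.lTensor (Module.Dual k V ⊗[k] H) (quasiFactorialRight δ n)
      (quasiIntRight δ n u) = 0 :=
  (consEquiv k (Module.Dual k V ⊗[k] H) n).map_eq_zero_iff.1 hu

omit [Module.Finite k V] in
theorem contractF_lTensor_subtype_mem {n : ℕ} {D : Submodule k (⨂[k]^n (Module.Dual k V))}
    (v : V) (z : (Module.Dual k V ⊗[k] H) ⊗[k] D) :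
    contractF δ n v (LinearMap.lTensor (Module.Dual k V ⊗[k] H) D.subtype z) ∈
      rangeH δ * (D.map TensorPower.toTensorAlgebra).map (incF δ).toLinearMap := by
  induction z using TensorProduct.induction_on with
  | zero => simp
  | add x y hx hy => simpa using add_mem hx hy
  | tmul y t =>
    induction y using TensorProduct.induction_on with
    | zero => simp
    | add x y hx hy => simpa only [TensorProduct.add_tmul, map_add] using add_mem hx hy
    | tmul f h =>
      rw [LinearMap.lTensor_tmul, contractF_tmul]
      exact Submodule.smul_mem _ _ (Submodule.mul_mem_mul ⟨h, rfl⟩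
        (Submodule.mem_map_of_mem (Submodule.mem_map_of_mem t.2)))

theorem contractF_quasiIntRight_mem {n : ℕ} {u : ⨂[k]^(n + 1) (Module.Dual k V)}
    (hu : quasiFactorialRight δ (n + 1) u = 0) (v : V) :
    contractF δ n v (quasiIntRight δ n u) ∈ rangeH δ *
      (gradedSpan fun n => LinearMap.ker (quasiFactorialRight δ n)).map (incF δ).toLinearMap := by
  obtain ⟨z, hz⟩ := exists_lTensor_subtype_eq (lTensor_quasiFactorialRight_quasiIntRight hu)
  rw [← hz]
  exact mul_le_mul_right (Submodule.map_mono
    (map_toTensorAlgebra_le_gradedSpan ker_quasiFactorialRight_zero n)) _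
    (contractF_lTensor_subtype_mem v z)

theorem idealF_eq_iSup_ker (hδ : IsQuasiYD δ) (hH : IsHopf k H) :
    (idealF δ).restrictScalars k = ⨆ n : ℕ, ⨆ _ : 1 ≤ n,
      (LinearMap.ker (quasiFactorialRight δ n)).map TensorPower.toTensorAlgebra :=
  le_antisymm
    (le_gradedSpan (idealF_isHomogeneous δ) (hasTriangularForm_sumTriangular hδ).plus_le
      (quasiFactorialRight_eq_zero hδ))
    (gradedSpan_le_idealF (fun _ _ hu => contractF_quasiIntRight_mem hu) hH)

end FactorialKernels

end BraidedDouble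

end

theorem theoremB {k : Type*} {H : Type*} {V : Type*} [Field k] [Ring H] [Bialgebra k H]
    [AddCommGroup V] [Module k V] [Module H V] [IsScalarTower k H V] [Module.Finite k V]
    (δ : V →ₗ[k] H ⊗[k] V) (hδ : BraidedDouble.IsQuasiYD δ) :
    -- the sum of all triangular ideals is the largest triangular ideal
    IsGreatest {J | BraidedDouble.IsTriangularIdeal δ J} (BraidedDouble.sumTriangular δ) ∧
    -- a triangular ideal determines its two halves, and every braided double has triangular
    -- decomposition
    (∀ J Im Ip, BraidedDouble.HasTriangularForm δ J Im Ip →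
      (J.comap (BraidedDouble.incV δ)).restrictScalars k = Im ∧
      (J.comap (BraidedDouble.incF δ)).restrictScalars k = Ip) ∧
    (∀ (A : Type*) [Ring A] [Algebra k A] (q : BraidedDouble.FreeDouble δ →ₐ[k] A),
      BraidedDouble.IsBraidedDouble δ q → Function.Bijective (BraidedDouble.triangularMap δ q)) ∧
    -- a braided double has no proper quotient doubles exactly when it is the quotient of the free
    -- double by the largest triangular ideal
    (∀ (A : Type*) [Ring A] [Algebra k A] (q : BraidedDouble.FreeDouble δ →ₐ[k] A),
      BraidedDouble.IsMinimalDouble δ q ↔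
        Function.Surjective q ∧ RingHom.ker q = BraidedDouble.sumTriangular δ) ∧
    -- every braided double has a unique quotient that is a minimal double
    (∀ (A : Type*) [Ring A] [Algebra k A] (q : BraidedDouble.FreeDouble δ →ₐ[k] A),
      BraidedDouble.IsBraidedDouble δ q →
        ∃! K : Ideal A, ∃ _ : K.IsTwoSided,
          BraidedDouble.IsMinimalDouble δ ((Ideal.Quotient.mkₐ k K).comp q)) ∧
    -- the defining ideals of the minimal double: two-sided, `H`-invariant, graded
    BraidedDouble.HasTriangularForm δ (BraidedDouble.sumTriangular δ)
      ((BraidedDouble.idealV δ).restrictScalars k) ((BraidedDouble.idealF δ).restrictScalars k) ∧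
    (BraidedDouble.idealV δ).IsTwoSided ∧ (BraidedDouble.idealF δ).IsTwoSided ∧
    (∀ (n : ℕ) (h : H) (t : ⨂[k]^n V),
      TensorPower.toTensorAlgebra t ∈ BraidedDouble.idealV δ →
        TensorPower.toTensorAlgebra (BraidedDouble.powAct (BraidedDouble.lact k H V) n h t) ∈
          BraidedDouble.idealV δ) ∧
    (∀ (n : ℕ) (h : H) (t : ⨂[k]^n (Module.Dual k V)),
      TensorPower.toTensorAlgebra t ∈ BraidedDouble.idealF δ →
        TensorPower.toTensorAlgebra (BraidedDouble.powAct (BraidedDouble.ract k H V) n h t) ∈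
          BraidedDouble.idealF δ) ∧
    (BraidedDouble.idealV δ).IsHomogeneous
      (fun n : ℕ => LinearMap.range (TensorAlgebra.ι k : V →ₗ[k] TensorAlgebra k V) ^ n) ∧
    (BraidedDouble.idealF δ).IsHomogeneous
      (fun n : ℕ => LinearMap.range
        (TensorAlgebra.ι k : Module.Dual k V →ₗ[k] TensorAlgebra k (Module.Dual k V)) ^ n) ∧
    -- over a Hopf algebra they are the sums of the kernels of the quasibraided factorials
    (BraidedDouble.IsHopf k H →
      (BraidedDouble.idealV δ).restrictScalars k =
        ⨆ n : ℕ, ⨆ _ : 1 ≤ n,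
          (LinearMap.ker (BraidedDouble.quasiFactorial δ n)).map TensorPower.toTensorAlgebra ∧
      (BraidedDouble.idealF δ).restrictScalars k =
        ⨆ n : ℕ, ⨆ _ : 1 ≤ n,
          (LinearMap.ker (BraidedDouble.quasiFactorialRight δ n)).map
            TensorPower.toTensorAlgebra) :=
  ⟨BraidedDouble.isGreatest_sumTriangular,
    fun _ _ _ hJ => ⟨hJ.comap_incV hδ, hJ.comap_incF hδ⟩,
    fun _ _ _ _ hq => BraidedDouble.triangularMap_bijective hδ hq,
    fun _ _ _ _ => BraidedDouble.isMinimalDouble_iff,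
    fun _ _ _ _ hq => BraidedDouble.existsUnique_minimal_quotient hq,
    BraidedDouble.hasTriangularForm_sumTriangular hδ,
    BraidedDouble.idealV_isTwoSided, BraidedDouble.idealF_isTwoSided,
    BraidedDouble.powAct_lact_mem_idealV hδ, BraidedDouble.powAct_ract_mem_idealF hδ,
    BraidedDouble.idealV_isHomogeneous δ, BraidedDouble.idealF_isHomogeneous δ,
    fun hH => ⟨BraidedDouble.idealV_eq_iSup_ker hδ hH, BraidedDouble.idealF_eq_iSup_ker hδ hH⟩⟩
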